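/- Let $N$ be a natural number. For a matrix function $F$ of a complex variable write $F^*(z):=(F(\bar z))^*$ and $F^{-*}:=(F^*)^{-1}$; $I$ is an identity matrix. **Setting.** Let $W:\mathbb R\to\mathbb C^{N\times N}$ be smooth and Hermitian positive definite at every point, with $\int |x|^k |W_{ij}|\,dx<\infty$ and $\int |x|^k|W_{ij}'|\,dx<\infty$ for all $k\ge 0$. Put $(P,Q)_W=\int_{\mathbb R}P(x)W(x)Q(x)^*dx$ for matrix polynomials $P,Q$. Let $\widehat P_n(x)=\sum_{j=0}^n a_{n,j}x^j$, $a_{n,n}=I$, $n\ge 0$, be the monic polynomials with $(\widehat P_n,Q)_W=0$ for all $Q$ of degree $<n$. Let $\kappa_n$ be matrices such that $(\kappa_n\widehat P_n,\kappa_l\widehat P_l)_W=\delta_{n,l}I$, and put $\gamma_n=\kappa_n^*\kappa_n$ and $b_{n,k}=\int x^k\widehat P_n(x)W(x)\,dx$ for $k\ge n$, $b_{n,k}=0$ for $k<n$. Let $Y^n:\mathbb C\setminus\mathbb R\to\mathbb C^{2N\times 2N}$ be the solution of the Riemann–Hilbert problem: $Y^n$ is analytic in $\mathbb C\setminus\mathbb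 R$; it has continuous boundary values $Y^n_\pm$ on $\mathbb R$ from the upper and lower half plane, with $Y^n_+(x)=Y^n_-(x)\begin{pmatrix}I&W(x)\\0&I\end{pmatrix}$; and there are constant matrices $Y^n_i$ such that $Y^n(z)=\bigl(I+\sum_{i=1}^m Y_i^n z^{-i}+O(z^{-m-1})\bigr)\begin{pmatrix}z^nI&0\\0&z^{-n}I\end{pmatrix}$ as $z\to\infty$, for every $m$. For a matrix polynomial $G(z)=\sum_{j=0}^m M_jz^j$ of degree $m$ put $\widehat P_{n,k}(z)=z^kI+a_{n,n-1}z^{k-1}+\dots+a_{n,n-k}$ (with $a_{n,j}=0$ for $j<0$), $\Delta_{j,n}(z)=\sum_{k=0}^j\widehat P_{n,k}(z)M_{m-j+k}$, $$\mathcal A_n(z;G)=-\gamma_n\sum_{j=0}^{m-1}\bigl(b_{n,n+m-j-1}\Delta_{j,n}^*(z)+\Delta_{j,n}(z)b_{n,n+m-j-1}^*\bigr),$$ $$\mathcal B_n(z;G)=-\Bigl(\sum_{j=0}^{m}\bigl(\Delta_{j,n}(z)b_{n-1,n+m-j-1}^*+b_{n,n+m-j-2}\Delta_{j,n-1}^*(z)\bigr)\Bigr)\gamma_{n-1}\quad(n\ge1),\qquad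 \mathcal B_0(z;G)=-G(z),$$ $$F_n(z;G)=\begin{pmatrix}-\mathcal B_n(z;G)&-\frac1{2\pi i}\gamma_n^{-1}\mathcal A_n(z;G)\\ 2\pi i\,\mathcal A_{n-1}(z;G)\gamma_{n-1}&\mathcal B_n^*(z;G)\end{pmatrix},$$ where the lower left block is $0$ for $n=0$. **Hypotheses.** Let $T$ be an entire $N\times N$ matrix function with $W(x)=T(x)T^*(x)$ for $x\in\mathbb R$, and let $G$ be a matrix polynomial with $T'(z)=G(z)T(z)$ in a neighbourhood of the origin. Let $S$ be an entire $N\times N$ matrix function, non-singular on $\mathbb C$ and unitary on $\mathbb R$, such that $$H(z)=T(z)S'(z)S^*(z)T^{-1}(z),\qquad z\in\mathbb C,$$ is a matrix polynomial. Put $\widetilde T=TS$, $\chi=S'S^*$ and $X^n=Y^n\begin{pmatrix}T&0\\0&T^{-*}\end{pmatrix}$. **Claim.** Then $$W(x)=\widetilde T(x)\widetilde T^*(x)\ (x\in\mathbb R),\qquad \widetilde T'(z)=(G(z)+H(z))\widetilde T(z)\ (z\in\mathbb C),$$ and, for every $n\ge 0$ and $z\in\mathbb C\setminus\mathbb R$,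 $X^n$ satisfies $$\frac{d}{dz}X^n(z)=F_n(z;G)X^n(z)$$ and also $$\frac{d}{dz}X^n(z)=\bigl(F_n(z;G)+F_n(z;H)\bigr)X^n(z)-X^n(z)\begin{pmatrix}\chi(z)&0\\0&-\chi^*(z)\end{pmatrix}.$$ -/

import Mathlib

open scoped Matrix ContDiff Topology ComplexOrder
open Filter MeasureTheory Polynomial

namespace MatrixOP

/-- `N × N` complex matrices. -/
abbrev Mat (N : ℕ) := Matrix (Fin N) (Fin N) ℂ

/-- `2N × 2N` complex matrices, written in `N × N` blocks. -/
abbrev BlockMat (N : ℕ) := Matrix (Fin N ⊕ Fin N) (Fin N ⊕ Fin N) ℂ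

noncomputable section

/-! ### Calculus of matrix-valued functions, entry by entry -/

/-- The matrix function `F` has the complex derivative `F'` at `z`. -/
def HasMatDerivAt {ι : Type*} (F : ℂ → Matrix ι ι ℂ) (F' : Matrix ι ι ℂ) (z : ℂ) : Prop :=
  ∀ i j, HasDerivAt (fun w => F w i j) (F' i j) z

/-- The derivative of a matrix function. -/
def matDeriv {ι : Type*} (F : ℂ → Matrix ι ι ℂ) (z : ℂ) : Matrix ι ι ℂ :=
  Matrix.of fun i j => deriv (fun w => F w i j) z

/-- The matrix function `F` is entire. -/
def Entire {ι : Type*} (F : ℂ → Matrix ι ι ℂ) : Prop :=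
  ∀ i j, Differentiable ℂ (fun z => F z i j)

/-- The integral over the real line of a matrix function. -/
def matIntegral {ι : Type*} (F : ℝ → Matrix ι ι ℂ) : Matrix ι ι ℂ :=
  Matrix.of fun i j => ∫ x : ℝ, F x i j

/-- `F^*(z) = (F (conj z))^*`. -/
def adj {ι : Type*} (F : ℂ → Matrix ι ι ℂ) (z : ℂ) : Matrix ι ι ℂ :=
  (F (starRingEnd ℂ z))ᴴ

/-- The value at the scalar `z` of a polynomial with matrix coefficients. -/
def pval {N : ℕ} (Q : (Mat N)[X]) (z : ℂ) : Mat N :=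
  ∑ k ∈ Finset.range (Q.natDegree + 1), z ^ k • Q.coeff k

/-! ### Weights and orthogonal polynomials -/

/-- A smooth positive definite matrix weight on the real line such that `W` and `W'` have finite
moments of all orders. -/
structure IsWeight {N : ℕ} (W : ℝ → Mat N) : Prop where
  posDef : ∀ x, (W x).PosDef
  smooth : ∀ i j, ContDiff ℝ ∞ (fun x => W x i j)
  moments : ∀ (k : ℕ) i j, Integrable (fun x : ℝ => ((|x| ^ k : ℝ) : ℂ) * W x i j)
  moments_deriv : ∀ (k : ℕ) i j,
    Integrable (fun x : ℝ => ((|x| ^ k : ℝ) : ℂ) * deriv (fun t : ℝ => W t i j) x)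

/-- The matrix-valued inner product `(P, Q)_W = ∫ P(x) W(x) Q(x)^* dx`. -/
def wip {N : ℕ} (W : ℝ → Mat N) (P Q : (Mat N)[X]) : Mat N :=
  matIntegral fun x => pval P x * W x * (pval Q x)ᴴ

/-- `P n`, `n ≥ 0`, are the monic orthogonal polynomials of the weight `W`. -/
def IsMonicOrthogonal {N : ℕ} (W : ℝ → Mat N) (P : ℕ → (Mat N)[X]) : Prop :=
  ∀ n : ℕ, (P n).natDegree ≤ n ∧ (P n).coeff n = 1 ∧
    ∀ Q : (Mat N)[X], Q.natDegree < n → wip W (P n) Q = 0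

/-- `κ n` are leading coefficients that make the polynomials `κ n * P n` orthonormal. -/
def IsNormalizing {N : ℕ} (W : ℝ → Mat N) (P : ℕ → (Mat N)[X]) (κ : ℕ → Mat N) : Prop :=
  ∀ n l : ℕ, wip W (C (κ n) * P n) (C (κ l) * P l) = if n = l then 1 else 0

/-- `γ_n = κ_n^* κ_n`. -/
def gam {N : ℕ} (κ : ℕ → Mat N) (n : ℕ) : Mat N := (κ n)ᴴ * κ n

/-- `b_{n,k} = ∫ x^k P_n(x) W(x) dx` for `k ≥ n`. The value is `0` for `k < n`, which is what
orthogonality gives when `0 ≤ k < n`. -/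
def bcoef {N : ℕ} (W : ℝ → Mat N) (P : ℕ → (Mat N)[X]) (n : ℕ) (k : ℤ) : Mat N :=
  if (n : ℤ) ≤ k then matIntegral fun x : ℝ => ((x : ℂ) ^ k.toNat) • (pval (P n) x * W x) else 0

/-! ### The Riemann–Hilbert problem -/

/-- `Y` solves the Riemann–Hilbert problem of order `n` for the weight `W` on the real line. -/
structure IsRHSolution {N : ℕ} (W : ℝ → Mat N) (n : ℕ) (Y : ℂ → BlockMat N) : Prop where
  analytic : ∀ i j, DifferentiableOn ℂ (fun z => Y z i j) {z : ℂ | z.im ≠ 0}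
  jump : ∃ Yp Ym : ℝ → BlockMat N, Continuous Yp ∧ Continuous Ym ∧
    (∀ x : ℝ, Tendsto Y (𝓝[{z : ℂ | 0 < z.im}] (x : ℂ)) (𝓝 (Yp x))) ∧
    (∀ x : ℝ, Tendsto Y (𝓝[{z : ℂ | z.im < 0}] (x : ℂ)) (𝓝 (Ym x))) ∧
    ∀ x : ℝ, Yp x = Ym x * Matrix.fromBlocks 1 (W x) 0 1
  asymptotics : ∃ c : ℕ → BlockMat N, ∀ m : ℕ, ∀ i j,
    (fun z : ℂ =>
      (Y z * Matrix.fromBlocks ((z ^ n)⁻¹ • (1 : Mat N)) 0 0 (z ^ n • (1 : Mat N))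
        - (1 + ∑ l ∈ Finset.Icc 1 m, (z ^ l)⁻¹ • c l)) i j)
      =O[Bornology.cobounded ℂ ⊓ 𝓟 {z : ℂ | z.im ≠ 0}] fun z : ℂ => (z ^ (m + 1))⁻¹

/-- `V = diag (T, T^{-*})`. -/
def Vmat {N : ℕ} (T : ℂ → Mat N) (z : ℂ) : BlockMat N :=
  Matrix.fromBlocks (T z) 0 0 (adj T z)⁻¹

/-- `X = Y V`. -/
def Xmat {N : ℕ} (Y : ℂ → BlockMat N) (T : ℂ → Mat N) (z : ℂ) : BlockMat N :=
  Y z * Vmat T z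

/-! ### The coefficient matrix of the differential equation -/

/-- `P_{n,k}(z) = z^k + a_{n,n-1} z^{k-1} + ⋯ + a_{n,n-k}`, where `a_{n,j}` is the coefficient of
`z^j` in `P_n` (zero for `j < 0`). -/
def trunc {N : ℕ} (P : ℕ → (Mat N)[X]) (n k : ℕ) (z : ℂ) : Mat N :=
  ∑ l ∈ Finset.range (k + 1), if l ≤ n then z ^ (k - l) • (P n).coeff (n - l) else 0

/-- `Δ_{j,n}(z) = ∑_{k=0}^{j} P_{n,k}(z) M_{m-j+k}`, for `G = ∑_{j=0}^{m} M_j z^j` and `j ≤ m`. -/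
def Del {N : ℕ} (P : ℕ → (Mat N)[X]) (G : (Mat N)[X]) (j n : ℕ) (z : ℂ) : Mat N :=
  ∑ k ∈ Finset.range (j + 1), trunc P n k z * G.coeff (G.natDegree - j + k)

/-- The polynomial `𝓐_n(z; G)`; here `m = deg G`. -/
def Acal {N : ℕ} (W : ℝ → Mat N) (P : ℕ → (Mat N)[X]) (κ : ℕ → Mat N) (G : (Mat N)[X])
    (n : ℕ) (z : ℂ) : Mat N :=
  -(gam κ n * ∑ j ∈ Finset.range G.natDegree,
    (bcoef W P n ((n : ℤ) + G.natDegree - j - 1) * adj (Del P G j n) z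
      + Del P G j n z * (bcoef W P n ((n : ℤ) + G.natDegree - j - 1))ᴴ))

/-- The polynomial `𝓑_n(z; G)`; here `m = deg G`. For `n = 0` the formula is read with the usual
conventions `P_{-1} = 0` and `γ_{-1} b_{-1,k} = δ_{k,-1}`, which give `𝓑_0 = -G`. -/
def Bcal {N : ℕ} (W : ℝ → Mat N) (P : ℕ → (Mat N)[X]) (κ : ℕ → Mat N) (G : (Mat N)[X]) :
    ℕ → ℂ → Mat N
  | 0, z => -pval G z
  | n + 1, z =>
    -((∑ j ∈ Finset.range (G.natDegree + 1),
      (Del P G j (n + 1) z * (bcoef W P n (((n + 1 : ℕ) : ℤ) + G.natDegree - j - 1))ᴴ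
        + bcoef W P (n + 1) (((n + 1 : ℕ) : ℤ) + G.natDegree - j - 2) * adj (Del P G j n) z))
      * gam κ n)

/-- The lower left block `2πi 𝓐_{n-1}(z; G) γ_{n-1}` of `F_n(z; G)`, with `γ_{-1} = 0`. -/
def lowerLeft {N : ℕ} (W : ℝ → Mat N) (P : ℕ → (Mat N)[X]) (κ : ℕ → Mat N) (G : (Mat N)[X]) :
    ℕ → ℂ → Mat N
  | 0, _ => 0
  | n + 1, z => (2 * (Real.pi : ℂ) * Complex.I) • (Acal W P κ G n z * gam κ n)

/-- The coefficient matrix `F_n(z; G)`. -/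
def Fmat {N : ℕ} (W : ℝ → Mat N) (P : ℕ → (Mat N)[X]) (κ : ℕ → Mat N) (G : (Mat N)[X])
    (n : ℕ) (z : ℂ) : BlockMat N :=
  Matrix.fromBlocks
    (-Bcal W P κ G n z)
    (-((2 * (Real.pi : ℂ) * Complex.I)⁻¹ • ((gam κ n)⁻¹ * Acal W P κ G n z)))
    (lowerLeft W P κ G n z)
    (adj (Bcal W P κ G n) z)

/-- `χ(z) = S'(z) S^*(z)`. -/
def chi {N : ℕ} (S : ℂ → Mat N) (z : ℂ) : Mat N := matDeriv S z * adj S z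

end

end MatrixOP

/-! Let J be the block matrix `swapMat` and V = diag(T, T^{-*}), so that X = Y V. On the real line W
T^{-*} = T. Hence the jump of Y, moved through V, becomes the constant unipotent matrix `jumpMat`,
and X' has the same jump as X. Therefore X' X⁻¹ has no jump and is entire. The inverse is not
assumed: by `IsFactorization.Xmat_symm` it equals J X^* J. It is thus enough to study the
expressions X₁ J X₂^* J, which are entire whenever both factors have the jump `jumpMat`
(`exists_entire_sandwich`).

At infinity V disappears from these expressions because V J V^* = J, so the growth of T never
enters. The factors z^{±n} cancel for the same reason (`conj_diag_eq_normalized`). With U = Y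
diag(z^{-n}, z^n), what remains of X' J X^* J is a term U' J U^* J, a term of size n/z, and U
diag(G, -G^*) J U^* J. The last term has a polynomial part `polyPart`, read off from the asymptotic
coefficients of U. The term with U' is controlled by Cauchy's estimate only up to 1/|Im z|, since
the expansion is given off the real line. The Liouville theorem `eq_zero_of_isBigO_inv_im` accepts
exactly this bound, and it yields X' = `polyPart c G` X.

It remains to compute the coefficients. The first block column of Y has no jump, so it is
polynomial. Integrating the jump of the second column against x^k expresses its coefficients as
moments of the first (`IsRHSolution.integral_row`). Comparing moments identifies the first column
with P_n and -2πi γ_{n-1} P_{n-1} (`rowPoly_inl`, `rowPoly_inr`). Rearranging the finite convolution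
(`convSum_eq_sum`, `convSum_shift`) then turns `polyPart` into `Fmat`.

For the second equation, χ = S' S^* is entire with χ^* = -χ, and H T = T χ. So diag(χ, -χ^*) =
diag(χ, χ) commutes with the jump, and X diag(χ, χ) X⁻¹ is again entire. The same Liouville argument
identifies it with F_n(z; H) (`IsFactorization.polyPart_mul_Xmat`), so the two additional terms
cancel. -/

namespace MatrixOP

section

/-! ### Holomorphic functions off the real line -/

/-- Neighbourhoods of infinity in the complement of the real line. -/
noncomputable abbrev offReal : Filter ℂ := Bornology.cobounded ℂ ⊓ 𝓟 {z : ℂ | z.im ≠ 0}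

theorem isOpen_im_ne_zero : IsOpen {z : ℂ | z.im ≠ 0} :=
  isOpen_ne_fun Complex.continuous_im continuous_const

theorem isOpen_im_pos : IsOpen {z : ℂ | 0 < z.im} :=
  isOpen_lt continuous_const Complex.continuous_im

theorem eventually_offReal_iff {p : ℂ → Prop} :
    (∀ᶠ z in offReal, p z) ↔ ∃ R : ℝ, ∀ z : ℂ, R ≤ ‖z‖ → z.im ≠ 0 → p z := by
  rw [eventually_inf_principal, ← comap_norm_atTop, eventually_comap, eventually_atTop]
  refine ⟨fun ⟨R, h⟩ => ⟨R, fun z hz hi => h _ hz z rfl hi⟩,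
    fun ⟨R, h⟩ => ⟨R, fun b hb z hz hi => h z (hz ▸ hb) hi⟩⟩

theorem eventually_offReal_im_ne_zero : ∀ᶠ z in offReal, z.im ≠ 0 :=
  eventually_offReal_iff.2 ⟨0, fun _ _ h => h⟩

theorem eventually_offReal_ne_zero : ∀ᶠ z in offReal, z ≠ 0 :=
  eventually_offReal_im_ne_zero.mono fun z hz h => hz (by simp [h])

/-- A continuous function that is holomorphic off the real line is entire. -/
theorem differentiable_of_continuous_of_differentiableOn {f : ℂ → ℂ} (hc : Continuous f)
    (hd : DifferentiableOn ℂ f {z : ℂ | z.im ≠ 0}) : Differentiable ℂ f := by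
  rw [← differentiableOn_univ,
    ← Complex.isConservativeOn_and_continuousOn_iff_isDifferentiableOn isOpen_univ]
  refine ⟨fun z w _ => ?_, hc.continuousOn⟩
  rw [← add_eq_zero_iff_eq_neg, Complex.wedgeIntegral_add_wedgeIntegral_eq]
  -- Morera: the rectangle with corners z, w is cut along the real axis. Each piece has a side on
  -- the axis, so f is holomorphic in its interior and continuous up to the boundary, and Cauchy's
  -- theorem applies. Oriented integrals also cover the case of z and w on the same side.
  have key : ∀ a b : ℂ, a.im = 0 ∨ b.im = 0 →
      (∫ x : ℝ in a.re..b.re, f (x + a.im * Complex.I)) -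
      (∫ x : ℝ in a.re..b.re, f (x + b.im * Complex.I)) +
      Complex.I • (∫ y : ℝ in a.im..b.im, f (b.re + y * Complex.I)) -
      Complex.I • (∫ y : ℝ in a.im..b.im, f (a.re + y * Complex.I)) = 0 := by
    intro a b hab
    refine Complex.integral_boundary_rect_eq_zero_of_continuousOn_of_differentiableOn f a b
      hc.continuousOn (hd.mono ?_)
    rintro u ⟨-, hu⟩
    simp only [Set.mem_preimage, Set.mem_Ioo, min_lt_iff, lt_max_iff] at hu
    change u.im ≠ 0
    rcases hab with h | h <;> grind
  have h₁ := key z (w.re : ℂ) (Or.inr (by simp))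
  have h₂ := key (z.re : ℂ) w (Or.inl (by simp))
  simp only [Complex.ofReal_re, Complex.ofReal_im] at h₁ h₂
  have hi : ∀ (c a b : ℝ), IntervalIntegrable (fun y : ℝ => f (c + y * Complex.I)) volume a b :=
    fun c a b => (hc.comp (by fun_prop)).intervalIntegrable a b
  rw [← intervalIntegral.integral_add_adjacent_intervals (hi w.re z.im 0) (hi w.re 0 w.im),
    ← intervalIntegral.integral_add_adjacent_intervals (hi z.re z.im 0) (hi z.re 0 w.im)]
  simp only [smul_eq_mul] at *
  linear_combination h₁ + h₂

theorem nhds_ofReal_le (x : ℝ) : 𝓝 (x : ℂ) ≤ 𝓝[{z : ℂ | 0 < z.im}] (x : ℂ) ⊔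
    (𝓝[{z : ℂ | z.im < 0}] (x : ℂ) ⊔ 𝓝[{z : ℂ | z.im = 0}] (x : ℂ)) := by
  rw [← nhdsWithin_union, ← nhdsWithin_union, ← nhdsWithin_univ]
  refine nhdsWithin_mono _ fun z _ => ?_
  rcases lt_trichotomy z.im 0 with h | h | h <;> simp [h]

theorem tendsto_comp_re {g : ℝ → ℂ} (hg : Continuous g) (x : ℝ) (s : Set ℂ) :
    Tendsto (fun z : ℂ => g z.re) (𝓝[s] (x : ℂ)) (𝓝 (g x)) := by
  have := (hg.comp Complex.continuous_re).tendsto (x : ℂ)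
  simp only [Function.comp_def, Complex.ofReal_re] at this
  exact this.mono_left nhdsWithin_le_nhds

/-- A function that is holomorphic off the real line, with equal continuous boundary values from
both sides, extends to an entire function. -/
theorem exists_entire_extension {f : ℂ → ℂ} {g : ℝ → ℂ}
    (hf : DifferentiableOn ℂ f {z : ℂ | z.im ≠ 0}) (hg : Continuous g)
    (hp : ∀ x : ℝ, Tendsto f (𝓝[{z : ℂ | 0 < z.im}] (x : ℂ)) (𝓝 (g x)))
    (hm : ∀ x : ℝ, Tendsto f (𝓝[{z : ℂ | z.im < 0}] (x : ℂ)) (𝓝 (g x))) :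
    ∃ F : ℂ → ℂ, Differentiable ℂ F ∧ ∀ z : ℂ, z.im ≠ 0 → F z = f z := by
  classical
  set F : ℂ → ℂ := fun z => if z.im = 0 then g z.re else f z with hF
  have hFf : ∀ z : ℂ, z.im ≠ 0 → F z = f z := fun z hz => by simp [hF, hz]
  have hd : DifferentiableOn ℂ F {z : ℂ | z.im ≠ 0} := hf.congr hFf
  refine ⟨F, differentiable_of_continuous_of_differentiableOn ?_ hd, hFf⟩
  rw [continuous_iff_continuousAt]
  intro z
  by_cases hz : z.im = 0
  · obtain ⟨x, rfl⟩ : ∃ x : ℝ, z = x := ⟨z.re, by apply Complex.ext <;> simp [hz]⟩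
    have hx : F x = g x := by simp [hF]
    rw [ContinuousAt, hx]
    refine Tendsto.mono_left (tendsto_sup.2 ⟨?_, tendsto_sup.2 ⟨?_, ?_⟩⟩) (nhds_ofReal_le x)
    · refine (hp x).congr' (eventually_nhdsWithin_of_forall fun w hw => (hFf w ?_).symm)
      exact ne_of_gt hw
    · refine (hm x).congr' (eventually_nhdsWithin_of_forall fun w hw => (hFf w ?_).symm)
      exact ne_of_lt hw
    · refine (tendsto_comp_re hg x _).congr' (eventually_nhdsWithin_of_forall fun w hw => ?_)
      simp [hF, show w.im = 0 from hw]
  · exact (hd.differentiableAt (isOpen_im_ne_zero.mem_nhds hz)).continuousAt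

/-- A Liouville theorem: an entire function that is `O(1 / Im z)` at infinity vanishes. -/
theorem eq_zero_of_isBigO_inv_im {f : ℂ → ℂ} (hf : Differentiable ℂ f)
    (h : f =O[offReal] fun z : ℂ => ((z.im : ℝ) : ℝ)⁻¹) (z : ℂ) : f z = 0 := by
  obtain ⟨C, hC⟩ := h.bound
  obtain ⟨R₀, hR₀⟩ := eventually_offReal_iff.1 hC
  have key : ∀ R : ℝ, R₀ ≤ R → ‖z‖ < R → 0 < R → ‖f z‖ ≤ |C| * (2 * R) / (R ^ 2 - ‖z‖ ^ 2) := by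
    intro R h0 hz hR
    have hpos : 0 < R ^ 2 - ‖z‖ ^ 2 := by nlinarith [norm_nonneg z]
    -- On the circle of radius R, R² = w w̄, so w² - R² = 2i w Im w. This factor absorbs the
    -- possible blow-up 1/|Im w| near ±R, and the product is at most 2R|C| on the circle. The
    -- maximum principle carries the bound to z, where it is divided by about R².
    have hg : Differentiable ℂ fun w : ℂ => (w ^ 2 - (R : ℂ) ^ 2) * f w := by fun_prop
    have hb := Complex.norm_le_of_forall_mem_frontier_norm_le (U := Metric.ball (0 : ℂ) R)
      Metric.isBounded_ball hg.diffContOnCl (C := |C| * (2 * R)) (z := z) ?_ ?_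
    · rw [le_div_iff₀ hpos]
      refine le_trans ?_ hb
      rw [norm_mul, mul_comm]
      refine mul_le_mul_of_nonneg_right ?_ (norm_nonneg _)
      have := norm_sub_norm_le ((R : ℂ) ^ 2) (z ^ 2)
      rw [norm_sub_rev, norm_pow, norm_pow, Complex.norm_real, Real.norm_of_nonneg hR.le] at this
      exact this
    · intro w hw
      rw [frontier_ball _ hR.ne', mem_sphere_zero_iff_norm] at hw
      have hfac : w ^ 2 - (R : ℂ) ^ 2 = w * (2 * w.im * Complex.I) := by
        have h1 : (R : ℂ) ^ 2 = w * (starRingEnd ℂ) w := by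
          rw [Complex.mul_conj, Complex.normSq_eq_norm_sq, hw]; push_cast; ring
        have h2 := Complex.sub_conj w
        rw [h1]
        push_cast at h2
        linear_combination w * h2
      by_cases hi : w.im = 0
      · simp [hfac, hi]; positivity
      · have hb := hR₀ w (hw ▸ h0) hi
        rw [hfac, norm_mul, norm_mul, norm_mul, norm_mul, hw]
        rw [norm_inv] at hb
        have hi' : 0 < ‖w.im‖ := norm_pos_iff.2 hi
        have : ‖f w‖ * ‖w.im‖ ≤ |C| := by
          calc ‖f w‖ * ‖w.im‖ ≤ C * ‖w.im‖⁻¹ * ‖w.im‖ := by gcongr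
            _ = C := by field_simp
            _ ≤ |C| := le_abs_self C
        simp only [Complex.norm_ofNat, Complex.norm_real, Complex.norm_I]
        nlinarith
    · exact subset_closure (by simpa using hz)
  have hlim : Tendsto (fun R : ℝ => |C| * (2 * R) / (R ^ 2 - ‖z‖ ^ 2)) atTop (𝓝 0) := by
    have h1 : Tendsto (fun R : ℝ => (R⁻¹ * (2 * |C|)) / (1 - ‖z‖ ^ 2 * R⁻¹ ^ 2)) atTop
        (𝓝 ((0 * (2 * |C|)) / (1 - ‖z‖ ^ 2 * 0 ^ 2))) := by
      refine Tendsto.div (tendsto_inv_atTop_zero.mul_const _)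
        (tendsto_const_nhds.sub ((tendsto_inv_atTop_zero.pow 2).const_mul _)) (by simp)
    simp only [zero_mul, zero_div] at h1
    refine h1.congr' ?_
    filter_upwards [eventually_gt_atTop 0, eventually_gt_atTop ‖z‖] with R hR hz
    have : R ^ 2 - ‖z‖ ^ 2 ≠ 0 := by nlinarith [norm_nonneg z]
    have h3 : 1 - ‖z‖ ^ 2 * R⁻¹ ^ 2 ≠ 0 := by
      have : 1 - ‖z‖ ^ 2 * R⁻¹ ^ 2 = (R ^ 2 - ‖z‖ ^ 2) / R ^ 2 := by field_simp
      rw [this]; positivity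
    rw [div_eq_div_iff h3 this]
    field_simp
  have : ‖f z‖ ≤ 0 := by
    refine ge_of_tendsto hlim ?_
    filter_upwards [eventually_ge_atTop R₀, eventually_gt_atTop ‖z‖, eventually_gt_atTop 0]
      with R h1 h2 h3 using key R h1 h2 h3
  simpa using this

theorem isBigO_inv_inv_im : (fun z : ℂ => z⁻¹) =O[offReal] fun z : ℂ => (z.im)⁻¹ := by
  refine Asymptotics.IsBigO.of_bound 1 (eventually_offReal_iff.2 ⟨0, fun z _ hz => ?_⟩)
  rw [norm_inv, norm_inv, one_mul, Real.norm_eq_abs]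
  exact inv_anti₀ (abs_pos.2 hz) (Complex.abs_im_le_norm z)

/-- An entire function that is `O(1 / z)` off the real line vanishes. -/
theorem eq_zero_of_isBigO_inv {f : ℂ → ℂ} (hf : Differentiable ℂ f)
    (h : f =O[offReal] fun z : ℂ => z⁻¹) (z : ℂ) : f z = 0 :=
  eq_zero_of_isBigO_inv_im hf (h.trans isBigO_inv_inv_im) z

/-- The symmetric integrals of the boundary value of a function that is holomorphic and `O(z⁻²)` in
the upper half plane tend to zero. -/
theorem tendsto_integral_boundary_zero {f : ℂ → ℂ} {g : ℝ → ℂ}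
    (hf : DifferentiableOn ℂ f {z : ℂ | 0 < z.im}) (hg : Continuous g)
    (hp : ∀ x : ℝ, Tendsto f (𝓝[{z : ℂ | 0 < z.im}] (x : ℂ)) (𝓝 (g x)))
    (hO : f =O[Bornology.cobounded ℂ ⊓ 𝓟 {z : ℂ | 0 < z.im}] fun z : ℂ => (z ^ 2)⁻¹) :
    Tendsto (fun R : ℝ => ∫ x in (-R)..R, g x) atTop (𝓝 0) := by
  classical
  set F : ℂ → ℂ := fun z => if 0 < z.im then f z else g z.re with hF
  have hFf : ∀ z : ℂ, 0 < z.im → F z = f z := fun z hz => by simp [hF, hz]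
  have hd : DifferentiableOn ℂ F {z : ℂ | 0 < z.im} := hf.congr hFf
  have hc : ContinuousOn F {z : ℂ | 0 ≤ z.im} := by
    intro z hz
    rcases (show 0 ≤ z.im from hz).eq_or_lt with h | h
    · obtain ⟨x, rfl⟩ : ∃ x : ℝ, z = x := ⟨z.re, by apply Complex.ext <;> simp [← h]⟩
      have hx : F x = g x := by simp [hF]
      rw [ContinuousWithinAt, hx]
      have hs : {z : ℂ | 0 ≤ z.im} = {z : ℂ | 0 < z.im} ∪ {z : ℂ | z.im = 0} := by
        ext w; simp [le_iff_lt_or_eq, eq_comm]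
      rw [hs, nhdsWithin_union]
      refine tendsto_sup.2 ⟨?_, ?_⟩
      · exact (hp x).congr' (eventually_nhdsWithin_of_forall fun w hw => (hFf w hw).symm)
      · refine (tendsto_comp_re hg x _).congr' (eventually_nhdsWithin_of_forall fun w hw => ?_)
        simp [hF, show w.im = 0 from hw]
    · exact (hd.differentiableAt (isOpen_im_pos.mem_nhds h)).continuousAt.continuousWithinAt
  obtain ⟨C, hC⟩ := hO.bound
  obtain ⟨R₀, hR₀⟩ : ∃ R₀ : ℝ, ∀ z : ℂ, R₀ ≤ ‖z‖ → 0 < z.im → ‖f z‖ ≤ C * ‖(z ^ 2)⁻¹‖ := by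
    rw [eventually_inf_principal, ← comap_norm_atTop, eventually_comap, eventually_atTop] at hC
    obtain ⟨R, h⟩ := hC
    exact ⟨R, fun z hz hi => h _ hz z rfl hi⟩
  have hbd : ∀ R : ℝ, R₀ ≤ R → 0 < R → ∀ z : ℂ, R ≤ ‖z‖ → 0 < z.im → ‖F z‖ ≤ |C| / R ^ 2 := by
    intro R h0 hR z hz hi
    rw [hFf z hi]
    refine (hR₀ z (h0.trans hz) hi).trans ?_
    rw [norm_inv, norm_pow, div_eq_mul_inv]
    gcongr
    exact le_abs_self C
  -- Cauchy's theorem on the rectangle [-R, R] × [0, R]. The three sides off the axis have total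
  -- length 4R, and the function is at most |C|/R² on them.
  have key : ∀ R : ℝ, R₀ ≤ R → 0 < R → ‖∫ x in (-R)..R, g x‖ ≤ 4 * |C| * R⁻¹ := by
    intro R h0 hR
    have hb := hbd R h0 hR
    have hrect := Complex.integral_boundary_rect_eq_zero_of_continuousOn_of_differentiableOn F
      (((-R : ℝ) : ℂ)) ((R : ℂ) + R * Complex.I) ?_ ?_
    · simp only [Complex.add_re, Complex.add_im, Complex.ofReal_re, Complex.ofReal_im,
        Complex.mul_re, Complex.mul_im, Complex.I_re, Complex.I_im, mul_zero, mul_one, zero_add,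
        sub_zero, add_zero, Complex.ofReal_zero, zero_mul] at hrect
      have e1 : (∫ x in (-R)..R, F (x : ℂ)) = ∫ x in (-R)..R, g x :=
        intervalIntegral.integral_congr fun x _ => by simp [hF]
      rw [e1] at hrect
      have b1 : ‖∫ x : ℝ in (-R)..R, F (x + R * Complex.I)‖ ≤ |C| / R ^ 2 * |R - -R| :=
        intervalIntegral.norm_integral_le_of_norm_le_const fun x _ => by
          refine hb _ ?_ (by simpa using hR)
          have := Complex.abs_im_le_norm ((x : ℂ) + R * Complex.I)
          simp only [Complex.add_im, Complex.ofReal_im, Complex.mul_im, Complex.ofReal_re,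
            Complex.I_im, Complex.I_re, mul_one, mul_zero, add_zero, zero_add] at this
          exact (le_abs_self R).trans this
      have b2 : ∀ a : ℝ, |a| = R →
          ‖∫ y : ℝ in (0 : ℝ)..R, F (a + y * Complex.I)‖ ≤ |C| / R ^ 2 * |R - 0| := fun a ha =>
        intervalIntegral.norm_integral_le_of_norm_le_const fun y hy => by
          rw [Set.uIoc_of_le hR.le] at hy
          refine hb _ ?_ (by simpa using hy.1)
          have := Complex.abs_re_le_norm ((a : ℂ) + y * Complex.I)
          simpa [ha] using this
      have b3 := b2 R (abs_of_pos hR)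
      have b4 := b2 (-R) (by rw [abs_neg, abs_of_pos hR])
      rw [show R - -R = 2 * R by ring, abs_of_pos (show 0 < 2 * R by positivity)] at b1
      rw [sub_zero, abs_of_pos hR] at b3 b4
      have : (∫ x in (-R)..R, g x) = (∫ x : ℝ in (-R)..R, F (x + R * Complex.I))
          - Complex.I * (∫ y : ℝ in (0 : ℝ)..R, F (R + y * Complex.I))
          + Complex.I * (∫ y : ℝ in (0 : ℝ)..R, F ((-R : ℝ) + y * Complex.I)) := by
        simp only [smul_eq_mul] at hrect
        linear_combination hrect
      rw [this]
      refine (norm_add_le _ _).trans ((add_le_add_left (norm_sub_le _ _) _).trans ?_)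
      rw [norm_mul, norm_mul, Complex.norm_I, one_mul, one_mul]
      have : |C| / R ^ 2 * (2 * R) + |C| / R ^ 2 * R + |C| / R ^ 2 * R = 4 * |C| * R⁻¹ := by
        field_simp; ring
      linarith
    · refine hc.mono fun u hu => ?_
      have := hu.2
      simp only [Complex.add_im, Complex.ofReal_re, Complex.ofReal_im,
        Complex.mul_im, Complex.I_re, Complex.I_im, mul_zero, mul_one, zero_add,
        Set.uIcc_of_le hR.le, Set.mem_preimage, Set.mem_Icc, add_zero] at this
      exact this.1
    · refine hd.mono fun u hu => ?_
      have := hu.2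
      simp only [Complex.add_im, Complex.ofReal_re, Complex.ofReal_im,
        Complex.mul_im, Complex.I_re, Complex.I_im, mul_zero, mul_one, zero_add,
        min_eq_left hR.le, Set.mem_preimage, Set.mem_Ioo, add_zero] at this
      exact this.1
  refine squeeze_zero_norm' (a := fun R : ℝ => 4 * |C| * R⁻¹) ?_ ?_
  · filter_upwards [eventually_ge_atTop R₀, eventually_gt_atTop 0] with R h1 h2 using key R h1 h2
  · simpa using tendsto_inv_atTop_zero.const_mul (4 * |C|)

/-- A reference function with tail 1/z whose only pole, -i, lies outside the closed upper half
plane. The real part is odd and integrates to zero; the imaginary part gives the arctangent, hence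
the limit -πi. -/
theorem integral_inv_add_I (R : ℝ) :
    ∫ x in (-R)..R, ((x : ℂ) + Complex.I)⁻¹ = -(2 * Real.arctan R : ℝ) * Complex.I := by
  have hne : ∀ x : ℝ, (x : ℂ) + Complex.I ≠ 0 := fun x h => by
    have := congrArg Complex.im h; simp at this
  have e : ∀ x : ℝ, ((x : ℂ) + Complex.I)⁻¹
      = ((x / (1 + x ^ 2) : ℝ) : ℂ) - (((1 + x ^ 2)⁻¹ : ℝ) : ℂ) * Complex.I := by
    intro x
    have h1 : ((1 : ℂ) + x ^ 2) ≠ 0 := by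
      have : (1 + x ^ 2 : ℝ) ≠ 0 := by positivity
      exact_mod_cast this
    push_cast
    refine inv_eq_of_mul_eq_one_right ?_
    field_simp
    linear_combination -Complex.I_sq
  have hc : Continuous fun x : ℝ => x / (1 + x ^ 2) :=
    continuous_id.div (by fun_prop) fun x => by positivity
  have hc' : Continuous fun x : ℝ => (1 + x ^ 2)⁻¹ :=
    Continuous.inv₀ (by fun_prop) fun x => by positivity
  have hodd : ∫ x in (-R)..R, x / (1 + x ^ 2) = 0 := by
    have := intervalIntegral.integral_comp_neg (a := -R) (b := R) fun x : ℝ => x / (1 + x ^ 2)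
    simp only [neg_sq, neg_neg, neg_div, intervalIntegral.integral_neg] at this
    linarith
  have hi : Continuous fun x : ℝ => ((x / (1 + x ^ 2) : ℝ) : ℂ) :=
    Complex.continuous_ofReal.comp hc
  have hi' : Continuous fun x : ℝ => (((1 + x ^ 2)⁻¹ : ℝ) : ℂ) * Complex.I :=
    (Complex.continuous_ofReal.comp hc').mul continuous_const
  simp_rw [e]
  rw [intervalIntegral.integral_sub (hi.intervalIntegrable _ _) (hi'.intervalIntegrable _ _),
    intervalIntegral.integral_mul_const, intervalIntegral.integral_ofReal,
    intervalIntegral.integral_ofReal, hodd, integral_inv_one_add_sq, Real.arctan_neg]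
  push_cast; ring

/-- The symmetric integrals of the boundary value of a function that is holomorphic in the upper
half plane and equal to `a / z + O(z⁻²)` there. -/
theorem tendsto_integral_boundary {f : ℂ → ℂ} {g : ℝ → ℂ} {a : ℂ}
    (hf : DifferentiableOn ℂ f {z : ℂ | 0 < z.im}) (hg : Continuous g)
    (hp : ∀ x : ℝ, Tendsto f (𝓝[{z : ℂ | 0 < z.im}] (x : ℂ)) (𝓝 (g x)))
    (hO : (fun z => f z - a * z⁻¹) =O[Bornology.cobounded ℂ ⊓ 𝓟 {z : ℂ | 0 < z.im}]
      fun z : ℂ => (z ^ 2)⁻¹) :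
    Tendsto (fun R : ℝ => ∫ x in (-R)..R, g x) atTop (𝓝 (-(Real.pi * Complex.I) * a)) := by
  have hne : ∀ z : ℂ, 0 ≤ z.im → z + Complex.I ≠ 0 := fun z hz h => by
    have := congrArg Complex.im h; simp at this; linarith
  have hne' : ∀ x : ℝ, (x : ℂ) + Complex.I ≠ 0 := fun x => hne x (by simp)
  have hcx : Continuous fun x : ℝ => a * ((x : ℂ) + Complex.I)⁻¹ :=
    continuous_const.mul (Continuous.inv₀ (by fun_prop) hne')
  -- Subtracting a/(z + i) rather than a/z removes the 1/z tail without creating a singularity on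
  -- the axis.
  have h0 := tendsto_integral_boundary_zero (f := fun z => f z - a * (z + Complex.I)⁻¹)
    (g := fun x => g x - a * ((x : ℂ) + Complex.I)⁻¹) ?_ (hg.sub hcx) ?_ ?_
  · have h1 : Tendsto (fun R : ℝ => a * (-(2 * Real.arctan R : ℝ) * Complex.I)) atTop
        (𝓝 (a * (-(2 * (Real.pi / 2) : ℝ) * Complex.I))) := by
      refine Tendsto.const_mul _ (Tendsto.mul_const _ (Tendsto.neg ?_))
      exact (Complex.continuous_ofReal.tendsto _).comp
        ((Real.tendsto_arctan_atTop.mono_right nhdsWithin_le_nhds).const_mul 2)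
    have h2 := h0.add h1
    have e : (0 : ℂ) + a * (-(2 * (Real.pi / 2) : ℝ) * Complex.I)
        = -(Real.pi * Complex.I) * a := by push_cast; ring
    rw [e] at h2
    refine h2.congr fun R => ?_
    rw [intervalIntegral.integral_sub (hg.intervalIntegrable _ _) (hcx.intervalIntegrable _ _),
      intervalIntegral.integral_const_mul, integral_inv_add_I]
    ring
  · refine hf.sub (DifferentiableOn.const_mul (DifferentiableOn.inv (by fun_prop) ?_) a)
    exact fun z hz => hne z (le_of_lt hz)
  · intro x
    refine (hp x).sub (Tendsto.mono_left ?_ nhdsWithin_le_nhds)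
    have : ContinuousAt (fun z : ℂ => a * (z + Complex.I)⁻¹) x :=
      continuousAt_const.mul (ContinuousAt.inv₀ (by fun_prop) (hne' x))
    exact this
  · have h1 : (fun z : ℂ => a * z⁻¹ - a * (z + Complex.I)⁻¹)
        =O[Bornology.cobounded ℂ ⊓ 𝓟 {z : ℂ | 0 < z.im}] fun z : ℂ => (z ^ 2)⁻¹ := by
      refine Asymptotics.IsBigO.of_bound (‖a‖) (eventually_inf_principal.2
        (Eventually.of_forall fun z hz => ?_))
      have hz' : z ≠ 0 := fun h => by simp [h] at hz
      have hzI := hne z (le_of_lt hz)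
      have e : a * z⁻¹ - a * (z + Complex.I)⁻¹ = a * Complex.I * (z⁻¹ * (z + Complex.I)⁻¹) := by
        field_simp; ring
      rw [e, norm_mul, norm_mul, Complex.norm_I, mul_one, norm_mul, norm_inv, norm_inv, norm_inv,
        norm_pow, sq, mul_inv]
      have hle : ‖z‖ ≤ ‖z + Complex.I‖ := by
        rw [Complex.norm_def, Complex.norm_def]
        refine Real.sqrt_le_sqrt ?_
        have : 0 < z.im := hz
        simp only [Complex.normSq_apply, Complex.add_re, Complex.add_im, Complex.I_re,
          Complex.I_im, add_zero]
        nlinarith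
      have : 0 < ‖z‖ := norm_pos_iff.2 hz'
      gcongr
    refine (hO.add h1).congr_left fun z => ?_
    ring

/-- The integral of the jump on the real line of a function that is holomorphic off the real line
and equal to `a / z + O(z⁻²)` at infinity, up to an entire function. -/
theorem integral_jump {f q : ℂ → ℂ} {gp gm : ℝ → ℂ} {a : ℂ} (hq : Differentiable ℂ q)
    (hf : DifferentiableOn ℂ f {z : ℂ | z.im ≠ 0}) (hgp : Continuous gp) (hgm : Continuous gm)
    (hp : ∀ x : ℝ, Tendsto f (𝓝[{z : ℂ | 0 < z.im}] (x : ℂ)) (𝓝 (gp x)))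
    (hm : ∀ x : ℝ, Tendsto f (𝓝[{z : ℂ | z.im < 0}] (x : ℂ)) (𝓝 (gm x)))
    (hO : (fun z => f z - (q z + a * z⁻¹)) =O[offReal] fun z : ℂ => (z ^ 2)⁻¹)
    (hint : Integrable fun x => gp x - gm x) :
    ∫ x, (gp x - gm x) = -(2 * Real.pi * Complex.I) * a := by
  have hqc : Continuous fun x : ℝ => q x := hq.continuous.comp Complex.continuous_ofReal
  have hle : (𝓟 {z : ℂ | 0 < z.im}) ≤ 𝓟 {z : ℂ | z.im ≠ 0} :=
    principal_mono.2 fun z hz => ne_of_gt hz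
  have hneg : Tendsto (fun z : ℂ => -z) (Bornology.cobounded ℂ ⊓ 𝓟 {z : ℂ | 0 < z.im}) offReal := by
    refine tendsto_inf.2 ⟨(tendsto_neg_cobounded).mono_left inf_le_left,
      tendsto_principal.2 (eventually_inf_principal.2 (Eventually.of_forall fun z hz => ?_))⟩
    simpa using ne_of_gt hz
  have h1 := tendsto_integral_boundary (f := fun z => f z - q z) (g := fun x => gp x - q x) (a := a)
    ((hf.mono fun z hz => ne_of_gt hz).sub hq.differentiableOn) (hgp.sub hqc)
    (fun x => (hp x).sub (hq.continuous.continuousAt.mono_left nhdsWithin_le_nhds))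
    ((hO.mono (inf_le_inf_left _ hle)).congr_left fun z => by ring)
  -- The reflection z ↦ -z brings the lower half plane to the upper one and turns the tail a/z into
  -- -a/z. The two boundary integrals therefore contribute equally to the jump, while q cancels in
  -- the difference.
  have h2 := tendsto_integral_boundary (f := fun z => f (-z) - q (-z))
    (g := fun x => gm (-x) - q (-x : ℝ)) (a := -a) ?_ ?_ ?_ ?_
  · have h3 := intervalIntegral_tendsto_integral hint tendsto_neg_atTop_atBot tendsto_id
    have h4 : Tendsto (fun R : ℝ => ∫ x in (-R)..R, (gp x - gm x)) atTop
        (𝓝 (-(Real.pi * Complex.I) * a - -(Real.pi * Complex.I) * -a)) := by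
      refine (h1.sub h2).congr fun R => ?_
      have e := intervalIntegral.integral_comp_neg (a := -R) (b := R) fun x : ℝ => gm x - q x
      rw [e, neg_neg, ← intervalIntegral.integral_sub]
      · refine intervalIntegral.integral_congr fun x _ => ?_
        simp
      · exact (hgp.sub hqc).intervalIntegrable _ _
      · exact (hgm.sub hqc).intervalIntegrable _ _
    rw [tendsto_nhds_unique h3 h4]
    ring
  · refine DifferentiableOn.sub ?_ (hq.comp differentiable_neg).differentiableOn
    exact hf.comp differentiable_neg.differentiableOn fun z hz => by simpa using ne_of_gt hz
  · exact (hgm.comp continuous_neg).sub (hqc.comp continuous_neg)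
  · intro x
    have ht : Tendsto (fun z : ℂ => -z) (𝓝[{z : ℂ | 0 < z.im}] (x : ℂ))
        (𝓝[{z : ℂ | z.im < 0}] ((-x : ℝ) : ℂ)) := by
      refine tendsto_nhdsWithin_iff.2 ⟨?_, eventually_nhdsWithin_of_forall fun z hz => ?_⟩
      · rw [Complex.ofReal_neg]
        exact continuous_neg.continuousAt.mono_left nhdsWithin_le_nhds
      · simpa using hz
    exact ((hm (-x)).comp ht).sub ((hq.continuous.continuousAt.mono_left nhdsWithin_le_nhds).comp ht)
  · refine ((hO.comp_tendsto hneg).congr_left fun z => ?_).congr_right fun z => ?_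
    · simp only [Function.comp_apply, inv_neg]; ring
    · simp

end

section

/-! ### Calculus of matrix functions -/

theorem HasMatDerivAt.mul {ι : Type*} [Fintype ι] {F F₁ : ℂ → Matrix ι ι ℂ}
    {F' F₁' : Matrix ι ι ℂ} {z : ℂ} (h : HasMatDerivAt F F' z) (h₁ : HasMatDerivAt F₁ F₁' z) :
    HasMatDerivAt (fun w => F w * F₁ w) (F' * F₁ z + F z * F₁') z := by
  intro i j
  simp only [Matrix.mul_apply, Matrix.add_apply, ← Finset.sum_add_distrib]
  exact HasDerivAt.fun_sum fun k _ => (h i k).mul (h₁ k j)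

theorem hasMatDerivAt_const {ι : Type*} (A : Matrix ι ι ℂ) (z : ℂ) :
    HasMatDerivAt (fun _ => A) 0 z := fun i j => hasDerivAt_const z (A i j)

section

variable {ι : Type*} {F F₁ : ℂ → Matrix ι ι ℂ} {F' F₁' : Matrix ι ι ℂ} {z : ℂ}

theorem HasMatDerivAt.unique (h : HasMatDerivAt F F' z) (h₁ : HasMatDerivAt F F₁' z) :
    F' = F₁' := by
  ext i j
  exact (h i j).unique (h₁ i j)

theorem HasMatDerivAt.congr (h : HasMatDerivAt F F' z) (h₁ : F₁ =ᶠ[𝓝 z] F) :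
    HasMatDerivAt F₁ F' z := fun i j =>
  (h i j).congr_of_eventuallyEq (h₁.mono fun w hw => by simp only [hw])

theorem HasMatDerivAt.matDeriv_eq (h : HasMatDerivAt F F' z) : matDeriv F z = F' := by
  ext i j
  exact (h i j).deriv

theorem Entire.hasMatDerivAt (h : Entire F) (z : ℂ) : HasMatDerivAt F (matDeriv F z) z :=
  fun i j => (h i j z).hasDerivAt

theorem Entire.matDeriv (h : Entire F) : Entire (matDeriv F) := fun i j => by
  have := ((h i j).contDiff (n := 2)).differentiable_deriv_two
  exact this

theorem Entire.sub (h : Entire F) (h₁ : Entire F₁) : Entire fun z => F z - F₁ z :=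
  fun i j => (h i j).sub (h₁ i j)

theorem entire_const (A : Matrix ι ι ℂ) : Entire fun _ => A :=
  fun i j => differentiable_const (A i j)

theorem Entire.sum {σ : Type*} {s : Finset σ} {F : σ → ℂ → Matrix ι ι ℂ}
    (h : ∀ k ∈ s, Entire (F k)) : Entire fun z => ∑ k ∈ s, F k z := fun i j => by
  simp only [Matrix.sum_apply]
  exact Differentiable.fun_sum fun k hk => h k hk i j

theorem Entire.smul {f : ℂ → ℂ} (hf : Differentiable ℂ f) (h : Entire F) :
    Entire fun z => f z • F z := fun i j => hf.mul (h i j)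

theorem hasDerivAt_adj_apply {F : ℂ → Matrix ι ι ℂ} {z : ℂ} {i j : ι} {f' : ℂ}
    (h : HasDerivAt (fun w => F w j i) f' (starRingEnd ℂ z)) :
    HasDerivAt (fun w => adj F w i j) (starRingEnd ℂ f') z := by
  have := h.conj_conj
  rwa [Complex.conj_conj] at this

theorem HasMatDerivAt.adj (h : HasMatDerivAt F F' (starRingEnd ℂ z)) :
    HasMatDerivAt (adj F) F'ᴴ z := fun i j => hasDerivAt_adj_apply (h j i)

theorem Entire.adj (h : Entire F) : Entire (adj F) :=
  fun i j _ => (hasDerivAt_adj_apply (h j i _).hasDerivAt).differentiableAt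

theorem Entire.matDeriv_adj (h : Entire F) (z : ℂ) :
    MatrixOP.matDeriv (MatrixOP.adj F) z = MatrixOP.adj (MatrixOP.matDeriv F) z :=
  (h.hasMatDerivAt (starRingEnd ℂ z)).adj.matDeriv_eq

theorem adj_ofReal (F : ℂ → Matrix ι ι ℂ) (x : ℝ) : adj F x = (F x)ᴴ := by
  simp [adj]

/-- Entire matrix functions that agree near the origin are equal. -/
theorem Entire.eq_of_eventually_eq (h : Entire F) (h₁ : Entire F₁)
    (he : ∀ᶠ z in 𝓝 (0 : ℂ), F z = F₁ z) (z : ℂ) : F z = F₁ z := by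
  ext i j
  have h0 : AnalyticOnNhd ℂ (fun z => F z i j) Set.univ := fun z _ => (h i j).analyticAt z
  have h1 : AnalyticOnNhd ℂ (fun z => F₁ z i j) Set.univ := fun z _ => (h₁ i j).analyticAt z
  exact congrFun (h0.eq_of_eventuallyEq h1 (he.mono fun w hw => by simp only [hw])) z

/-- Entire matrix functions that agree on the real line are equal. -/
theorem Entire.eq_of_eq_ofReal (h : Entire F) (h₁ : Entire F₁)
    (he : ∀ x : ℝ, F x = F₁ x) (z : ℂ) : F z = F₁ z := by
  ext i j
  have h0 : AnalyticOnNhd ℂ (fun z => F z i j) Set.univ := fun z _ => (h i j).analyticAt z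
  have h1 : AnalyticOnNhd ℂ (fun z => F₁ z i j) Set.univ := fun z _ => (h₁ i j).analyticAt z
  refine congrFun (h0.eq_of_frequently_eq h1 (z₀ := 0) ?_) z
  have ht : Tendsto (fun x : ℝ => (x : ℂ)) (𝓝[≠] 0) (𝓝[≠] 0) := by
    refine tendsto_nhdsWithin_iff.2 ⟨?_, eventually_nhdsWithin_of_forall fun x hx => ?_⟩
    · exact (Complex.continuous_ofReal.tendsto' 0 0 (by simp)).mono_left nhdsWithin_le_nhds
    · simpa using hx
  exact ht.frequently (Frequently.of_forall fun x => by simp only [he x])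

end

section

variable {ι : Type*} [Fintype ι] {F F₁ : ℂ → Matrix ι ι ℂ}

theorem Entire.mul (h : Entire F) (h₁ : Entire F₁) : Entire fun z => F z * F₁ z := fun i j => by
  simp only [Matrix.mul_apply]
  exact Differentiable.fun_sum fun k _ => (h i k).mul (h₁ k j)

theorem adj_mul (F F₁ : ℂ → Matrix ι ι ℂ) (z : ℂ) :
    adj (fun w => F w * F₁ w) z = adj F₁ z * adj F z := by
  simp [adj, Matrix.conjTranspose_mul]

variable [DecidableEq ι]

theorem Entire.det (h : Entire F) : Differentiable ℂ fun z => (F z).det := by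
  simp only [Matrix.det_apply]
  refine Differentiable.fun_sum fun σ _ => Differentiable.const_smul ?_ _
  exact Differentiable.fun_finsetProd fun i _ => h _ _

theorem Entire.nonsing_inv (h : Entire F) (hu : ∀ z, IsUnit (F z)) :
    Entire fun z => (F z)⁻¹ := by
  intro i j
  have hdet : ∀ z, (F z).det ≠ 0 := fun z => ((Matrix.isUnit_iff_isUnit_det _).1 (hu z)).ne_zero
  simp only [Matrix.inv_def, Ring.inverse_eq_inv', Matrix.smul_apply, smul_eq_mul]
  refine (h.det.inv hdet).mul ?_
  simp only [Matrix.adjugate_apply]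
  refine Entire.det fun k l => ?_
  by_cases hk : k = j
  · subst hk; simp
  · simpa [Matrix.updateRow_ne hk] using h k l

/-- Solutions of a linear differential equation stay non-singular. -/
theorem Entire.isUnit_of_matDeriv_eq {A : ℂ → Matrix ι ι ℂ} (h : Entire F) (hA : Entire A)
    (hd : ∀ z, MatrixOP.matDeriv F z = A z * F z) {w : ℂ} (hw : IsUnit (F w)) (z : ℂ) :
    IsUnit (F z) := by
  rw [Matrix.isUnit_iff_isUnit_det, isUnit_iff_ne_zero]
  intro hdet
  obtain ⟨v, hv, hFv⟩ := Matrix.exists_mulVec_eq_zero_iff.2 hdet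
  -- If v is in the kernel of F z, then t ↦ F (p t) v solves a linear equation along the segment
  -- from z to w and vanishes at t = 0. A Grönwall bound makes it vanish at t = 1, which contradicts
  -- the invertibility of F w.
  set p : ℝ → ℂ := fun t => z + t * (w - z) with hp
  have hpc : Continuous p := by fun_prop
  set u : ℝ → ι → ℂ := fun t => F (p t) *ᵥ v with hu
  have hpd : ∀ t, HasDerivAt p (w - z) t := fun t => by
    have := ((hasDerivAt_id (t : ℂ)).mul_const (w - z)).const_add z
    simpa [hp] using this.comp_ofReal
  have hderiv : ∀ t, HasDerivAt u ((w - z) • (A (p t) *ᵥ u t)) t := by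
    intro t
    rw [hasDerivAt_pi]
    intro i
    have e : ((w - z) • (A (p t) *ᵥ u t)) i
        = ∑ j, (MatrixOP.matDeriv F (p t) i j * (w - z)) * v j := by
      rw [hu]
      simp only [Matrix.mulVec_mulVec, ← hd]
      simp only [Pi.smul_apply, smul_eq_mul, Matrix.mulVec, dotProduct, Finset.mul_sum]
      exact Finset.sum_congr rfl fun j _ => by ring
    rw [e]
    exact HasDerivAt.fun_sum fun j _ =>
      (((h.hasMatDerivAt (p t) i j).comp t (hpd t)).mul_const (v j))
  have hAc : Continuous fun t => ∑ i, ∑ j, ‖A (p t) i j‖ :=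
    continuous_finsetSum _ fun i _ => continuous_finsetSum _ fun j _ =>
      ((hA i j).continuous.comp hpc).norm
  obtain ⟨K, hK⟩ := (isCompact_Icc (a := (0 : ℝ)) (b := 1)).bddAbove_image hAc.continuousOn
  have hbound : ∀ t ∈ Set.Ico (0 : ℝ) 1,
      ‖(w - z) • (A (p t) *ᵥ u t)‖ ≤ (‖w - z‖ * K) * ‖u t‖ := by
    intro t ht
    rw [norm_smul, mul_assoc]
    refine mul_le_mul_of_nonneg_left ?_ (norm_nonneg _)
    have hKt : ∑ i, ∑ j, ‖A (p t) i j‖ ≤ K := hK ⟨t, ⟨ht.1, ht.2.le⟩, rfl⟩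
    refine le_trans ?_ (mul_le_mul_of_nonneg_right hKt (norm_nonneg _))
    refine (pi_norm_le_iff_of_nonneg (by positivity)).2 fun i => ?_
    calc ‖(A (p t) *ᵥ u t) i‖ ≤ ∑ j, ‖A (p t) i j * u t j‖ := norm_sum_le _ _
      _ ≤ ∑ j, ‖A (p t) i j‖ * ‖u t‖ := Finset.sum_le_sum fun j _ => by
          rw [norm_mul]; gcongr; exact norm_le_pi_norm _ _
      _ = (∑ j, ‖A (p t) i j‖) * ‖u t‖ := (Finset.sum_mul _ _ _).symm
      _ ≤ _ := mul_le_mul_of_nonneg_right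
          (Finset.single_le_sum (f := fun i => ∑ j, ‖A (p t) i j‖)
            (fun i _ => by positivity) (Finset.mem_univ i)) (norm_nonneg _)
  have hzero := eq_zero_of_abs_deriv_le_mul_abs_self_of_eq_zero_right
    (fun t _ => (hderiv t).continuousAt.continuousWithinAt)
    (fun t _ => (hderiv t).hasDerivWithinAt) (by simp [hu, hp, hFv]) hbound 1 (by simp)
  have hwv : F w *ᵥ v = 0 := by simpa [hu, hp] using hzero
  exact hv (Matrix.mulVec_injective_of_isUnit hw (by simpa using hwv))

end

/-! ### Matrix polynomials -/

theorem pval_eq_sum_range {N : ℕ} (Q : (Mat N)[X]) {n : ℕ} (h : Q.natDegree < n) (z : ℂ) :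
    pval Q z = ∑ k ∈ Finset.range n, z ^ k • Q.coeff k := by
  refine Finset.sum_subset (Finset.range_mono h) fun k _ hk => ?_
  rw [Finset.mem_range, not_lt] at hk
  rw [Polynomial.coeff_eq_zero_of_natDegree_lt hk, smul_zero]

theorem entire_pval {N : ℕ} (Q : (Mat N)[X]) : Entire (pval Q) :=
  Entire.sum fun k _ => Entire.smul (by fun_prop) (entire_const _)

theorem adj_pval {N : ℕ} (Q : (Mat N)[X]) (z : ℂ) :
    adj (pval Q) z = ∑ k ∈ Finset.range (Q.natDegree + 1), z ^ k • (Q.coeff k)ᴴ := by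
  simp [adj, pval, Matrix.conjTranspose_sum]

end

section

/-! ### Asymptotics of matrix functions off the real line -/

/-- `F = O(g)` entry by entry at infinity, off the real line. -/
def MatO {ι : Type*} (F : ℂ → Matrix ι ι ℂ) (g : ℂ → ℂ) : Prop :=
  ∀ i j, (fun z => F z i j) =O[offReal] g

section

variable {ι : Type*} {F F₁ : ℂ → Matrix ι ι ℂ} {g g₁ : ℂ → ℂ}

theorem MatO.add (h : MatO F g) (h₁ : MatO F₁ g) : MatO (fun z => F z + F₁ z) g :=
  fun i j => (h i j).add (h₁ i j)

theorem MatO.trans (h : MatO F g) (hg : g =O[offReal] g₁) : MatO F g₁ :=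
  fun i j => (h i j).trans hg

theorem MatO.congr (h : MatO F g) (he : ∀ᶠ z in offReal, F z = F₁ z) : MatO F₁ g :=
  fun i j => (h i j).congr' (he.mono fun z hz => by simp only [hz]) EventuallyEq.rfl

theorem MatO.sum {σ : Type*} {s : Finset σ} {F : σ → ℂ → Matrix ι ι ℂ}
    (h : ∀ k ∈ s, MatO (F k) g) : MatO (fun z => ∑ k ∈ s, F k z) g := fun i j => by
  simp only [Matrix.sum_apply]
  exact Asymptotics.IsBigO.fun_sum fun k hk => h k hk i j

theorem MatO.smul {f : ℂ → ℂ} (hf : f =O[offReal] g₁) (h : MatO F g) :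
    MatO (fun z => f z • F z) fun z => g₁ z * g z := fun i j => hf.mul (h i j)

theorem MatO.mul {ι : Type*} [Fintype ι] {F F₁ : ℂ → Matrix ι ι ℂ} {g g₁ : ℂ → ℂ}
    (h : MatO F g) (h₁ : MatO F₁ g₁) :
    MatO (fun z => F z * F₁ z) fun z => g z * g₁ z := fun i j => by
  simp only [Matrix.mul_apply]
  exact Asymptotics.IsBigO.fun_sum fun k _ => (h i k).mul (h₁ k j)

theorem matO_const (A : Matrix ι ι ℂ) : MatO (fun _ => A) fun _ => 1 :=
  fun _ _ => Asymptotics.isBigO_const_const _ one_ne_zero _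

theorem MatO.mul_const {ι : Type*} [Fintype ι] {F : ℂ → Matrix ι ι ℂ} {g : ℂ → ℂ}
    (h : MatO F g) (A : Matrix ι ι ℂ) : MatO (fun z => F z * A) g := by
  simpa using h.mul (matO_const A)

theorem MatO.const_mul {ι : Type*} [Fintype ι] {F : ℂ → Matrix ι ι ℂ} {g : ℂ → ℂ}
    (h : MatO F g) (A : Matrix ι ι ℂ) : MatO (fun z => A * F z) g := by
  simpa using (matO_const A).mul h

/-- An entire matrix function that is `O(1 / Im z)` at infinity vanishes. -/
theorem Entire.eq_zero_of_matO (h : Entire F) (hO : MatO F fun z => (z.im : ℂ)⁻¹) (z : ℂ) :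
    F z = 0 := by
  ext i j
  refine eq_zero_of_isBigO_inv_im (h i j) ((hO i j).trans ?_) z
  exact Asymptotics.isBigO_of_le _ fun z => by simp

end

theorem isBigO_inv_pow_of_le {k m : ℕ} (h : k ≤ m) :
    (fun z : ℂ => (z ^ m)⁻¹) =O[offReal] fun z : ℂ => (z ^ k)⁻¹ := by
  refine Asymptotics.IsBigO.of_bound 1 (eventually_offReal_iff.2 ⟨1, fun z hz _ => ?_⟩)
  rw [norm_inv, norm_inv, norm_pow, norm_pow, one_mul]
  have : 0 < ‖z‖ := by linarith
  gcongr

theorem isBigO_inv_complex_inv_im :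
    (fun z : ℂ => z⁻¹) =O[offReal] fun z : ℂ => (z.im : ℂ)⁻¹ :=
  isBigO_inv_inv_im.trans (Asymptotics.isBigO_of_le _ fun z => by simp)

theorem tendsto_conj_offReal : Tendsto (starRingEnd ℂ) offReal offReal := by
  intro s hs
  obtain ⟨R, hR⟩ := eventually_offReal_iff.1 (show ∀ᶠ z in offReal, z ∈ s from hs)
  exact eventually_offReal_iff.2 ⟨R, fun z hz hi => hR _ (by simpa using hz) (by simpa using hi)⟩

/-- `U` has the asymptotic expansion `∑ c_l z^{-l}` at infinity, off the real line. -/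
def HasExpansion {ι : Type*} (U : ℂ → Matrix ι ι ℂ) (c : ℕ → Matrix ι ι ℂ) : Prop :=
  ∀ m, MatO (fun z => U z - ∑ l ∈ Finset.range (m + 1), (z ^ l)⁻¹ • c l)
    fun z => (z ^ (m + 1))⁻¹

section

variable {ι : Type*} {U : ℂ → Matrix ι ι ℂ} {c : ℕ → Matrix ι ι ℂ}

theorem matO_partialSum (c : ℕ → Matrix ι ι ℂ) (m : ℕ) :
    MatO (fun z => ∑ l ∈ Finset.range (m + 1), (z ^ l)⁻¹ • c l) fun _ => 1 := by
  refine MatO.sum fun l _ => ?_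
  have := MatO.smul (isBigO_inv_pow_of_le (Nat.zero_le l)) (matO_const (c l))
  simpa using this

theorem HasExpansion.matO_one (h : HasExpansion U c) : MatO U fun _ => 1 := by
  have h1 := (h 0).trans (isBigO_inv_pow_of_le (Nat.zero_le _))
  simp only [pow_zero, inv_one] at h1
  have h2 := h1.add (matO_partialSum c 0)
  exact h2.congr (Eventually.of_forall fun z => by simp)

theorem HasExpansion.adj (h : HasExpansion U c) :
    HasExpansion (adj U) fun l => (c l)ᴴ := by
  intro m i j
  have := (h m j i).comp_tendsto tendsto_conj_offReal
  refine (Asymptotics.IsBigO.of_norm_norm ?_)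
  refine (this.norm_norm.congr_left fun z => ?_).congr_right fun z => ?_
  · simp only [Function.comp_apply, MatrixOP.adj, Matrix.sub_apply, Matrix.sum_apply,
      Matrix.smul_apply, Matrix.conjTranspose_apply, smul_eq_mul]
    rw [← norm_star]
    simp
  · simp

end

section

variable {ι : Type*} [Fintype ι] {U V : ℂ → Matrix ι ι ℂ} {c d : ℕ → Matrix ι ι ℂ}

theorem HasExpansion.const_mul (h : HasExpansion U c) (A : Matrix ι ι ℂ) :
    HasExpansion (fun z => A * U z) fun l => A * c l := fun m =>
  ((h m).const_mul A).congr (Eventually.of_forall fun z => by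
    simp [Matrix.mul_sub, Matrix.mul_sum])

theorem HasExpansion.mul_const (h : HasExpansion U c) (A : Matrix ι ι ℂ) :
    HasExpansion (fun z => U z * A) fun l => c l * A := fun m =>
  ((h m).mul_const A).congr (Eventually.of_forall fun z => by
    simp [Matrix.sub_mul, Matrix.sum_mul])

/-- The polynomial part of `z^p U V`. -/
theorem HasExpansion.pow_smul_mul (hU : HasExpansion U c) (hV : HasExpansion V d) (p : ℕ) :
    MatO (fun z => z ^ p • (U z * V z) - ∑ l ∈ Finset.range (p + 1), ∑ k ∈ Finset.range (p + 1),
      if l + k ≤ p then z ^ (p - l - k) • (c l * d k) else 0) fun z => z⁻¹ := by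
  set A : ℂ → Matrix ι ι ℂ := fun z => ∑ l ∈ Finset.range (p + 1), (z ^ l)⁻¹ • c l with hA
  set B : ℂ → Matrix ι ι ℂ := fun z => ∑ l ∈ Finset.range (p + 1), (z ^ l)⁻¹ • d l with hB
  have h1 : MatO (fun z => (U z - A z) * V z) fun z => (z ^ (p + 1))⁻¹ := by
    simpa using (hU p).mul hV.matO_one
  have h2 : MatO (fun z => A z * (V z - B z)) fun z => (z ^ (p + 1))⁻¹ := by
    simpa using (matO_partialSum c p).mul (hV p)
  have hpow : (fun z : ℂ => z ^ p * (z ^ (p + 1))⁻¹) =O[offReal] fun z => z⁻¹ := by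
    refine EventuallyEq.isBigO ?_
    filter_upwards [eventually_offReal_ne_zero] with z hz
    rw [pow_succ, mul_inv, mul_inv_cancel_left₀ (pow_ne_zero _ hz)]
  have h3 := ((MatO.smul (Asymptotics.isBigO_refl (fun z : ℂ => z ^ p) _) (h1.add h2))).trans hpow
  -- The product of the two partial sums also contains pairs with l + k > p. They carry only
  -- negative powers of z and belong to the error.
  have h4 : MatO (fun z => ∑ l ∈ Finset.range (p + 1), ∑ k ∈ Finset.range (p + 1),
      if l + k ≤ p then 0 else (z ^ p * (z ^ (l + k))⁻¹) • (c l * d k)) fun z => z⁻¹ := by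
    refine MatO.sum fun l _ => MatO.sum fun k _ => ?_
    split_ifs with hlk
    · exact fun i j => Asymptotics.isBigO_zero _ _
    · have hp' : (fun z : ℂ => z ^ p * (z ^ (l + k))⁻¹) =O[offReal] fun z => z⁻¹ :=
        ((Asymptotics.isBigO_refl (fun z : ℂ => z ^ p) _).mul
          (isBigO_inv_pow_of_le (by omega : p + 1 ≤ l + k))).trans hpow
      simpa using MatO.smul hp' (matO_const (c l * d k))
  refine (h3.add h4).congr ?_
  filter_upwards [eventually_offReal_ne_zero] with z hz
  have e1 : (U z - A z) * V z + A z * (V z - B z) = U z * V z - A z * B z := by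
    rw [Matrix.sub_mul, Matrix.mul_sub]; abel
  have e2 : z ^ p • (A z * B z) = (∑ l ∈ Finset.range (p + 1), ∑ k ∈ Finset.range (p + 1),
      if l + k ≤ p then z ^ (p - l - k) • (c l * d k) else 0)
      + ∑ l ∈ Finset.range (p + 1), ∑ k ∈ Finset.range (p + 1),
      if l + k ≤ p then 0 else (z ^ p * (z ^ (l + k))⁻¹) • (c l * d k) := by
    simp only [hA, hB]
    rw [Matrix.sum_mul]
    simp only [Matrix.mul_sum, Finset.smul_sum, ← Finset.sum_add_distrib]
    refine Finset.sum_congr rfl fun l _ => Finset.sum_congr rfl fun k _ => ?_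
    rw [Matrix.smul_mul, Matrix.mul_smul, smul_smul, smul_smul]
    have e : z ^ p * (z ^ l)⁻¹ * (z ^ k)⁻¹ = z ^ p * (z ^ (l + k))⁻¹ := by
      rw [pow_add, mul_inv, mul_assoc]
    rw [e]
    split_ifs with hlk
    · rw [add_zero]
      congr 1
      rw [mul_inv_eq_iff_eq_mul₀ (pow_ne_zero _ hz), ← pow_add]
      congr 1; omega
    · rw [zero_add]
  rw [e1, smul_sub, e2]
  abel

end

end

/-! ### Derivative bounds and block identities for the normalized solution -/

section

/-- Cauchy's estimate near the real line. -/
theorem isBigO_deriv_inv_im {f : ℂ → ℂ} (hf : DifferentiableOn ℂ f {z : ℂ | z.im ≠ 0})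
    (hb : f =O[offReal] fun _ => (1 : ℂ)) : deriv f =O[offReal] fun z => (z.im : ℂ)⁻¹ := by
  obtain ⟨C, hC⟩ := hb.bound
  obtain ⟨R, hR⟩ := eventually_offReal_iff.1 hC
  refine Asymptotics.IsBigO.of_bound (2 * C) (eventually_offReal_iff.2 ⟨2 * |R|, fun z hz hi => ?_⟩)
  have hi' : 0 < |z.im| := abs_pos.2 hi
  -- The radius |Im z|/2 keeps the disc away from the real line. As it is at most ‖z‖/2 and ‖z‖ ≥
  -- 2|R|, the disc also stays in the region where f is bounded.
  have hball : ∀ w ∈ Metric.closedBall z (|z.im| / 2), R ≤ ‖w‖ ∧ w.im ≠ 0 := by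
    intro w hw
    rw [mem_closedBall_iff_norm] at hw
    have h1 := Complex.abs_im_le_norm (w - z)
    have h2 := Complex.abs_im_le_norm z
    rw [Complex.sub_im] at h1
    refine ⟨?_, fun h0 => ?_⟩
    · have h3 := norm_sub_norm_le z w
      rw [norm_sub_rev] at h3
      have := le_abs_self R
      linarith
    · rw [h0, zero_sub, abs_neg] at h1
      linarith
  have hd : DiffContOnCl ℂ f (Metric.ball z (|z.im| / 2)) := by
    refine DifferentiableOn.diffContOnCl (hf.mono fun w hw => ?_)
    exact (hball w (Metric.closure_ball_subset_closedBall hw)).2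
  refine (Complex.norm_deriv_le_of_forall_mem_sphere_norm_le (half_pos hi') hd
    (C := C) fun w hw => ?_).trans (le_of_eq ?_)
  · have h := hball w (Metric.sphere_subset_closedBall hw)
    simpa using hR w h.1 h.2
  · rw [norm_inv, Complex.norm_real, Real.norm_eq_abs]
    field_simp

/-! ### Block matrices -/

section

variable (N : ℕ)

/-- The block matrix that exchanges the two blocks. -/
abbrev swapMat : BlockMat N := Matrix.fromBlocks 0 1 1 0

/-- The jump matrix of `X` on the real line. -/
abbrev jumpMat : BlockMat N := Matrix.fromBlocks 1 1 0 1

/-- The inverse of the jump matrix of `X`. -/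
abbrev jumpInv : BlockMat N := Matrix.fromBlocks 1 (-1) 0 1

theorem swapMat_mul_self : swapMat N * swapMat N = 1 := by
  simp [Matrix.fromBlocks_multiply]

theorem jumpMat_mul_jumpInv : jumpMat N * jumpInv N = 1 := by
  simp [Matrix.fromBlocks_multiply]

/-- The jump matrix preserves the form J. This is what lets the jumps of X and of X^* cancel in X J
X^*. -/
theorem jumpInv_swapMat_jumpMat : jumpInv N * swapMat N * (jumpMat N)ᴴ = swapMat N := by
  simp [Matrix.fromBlocks_multiply, Matrix.fromBlocks_conjTranspose]

end

variable {N : ℕ}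

theorem entire_fromBlocks {A B C D : ℂ → Mat N} (hA : Entire A) (hB : Entire B) (hC : Entire C)
    (hD : Entire D) : Entire fun z => Matrix.fromBlocks (A z) (B z) (C z) (D z) := by
  rintro (i | i) (j | j)
  exacts [hA i j, hB i j, hC i j, hD i j]

/-- `diag (z^n, z^{-n})`. -/
noncomputable def powDiag (N n : ℕ) (z : ℂ) : BlockMat N :=
  Matrix.fromBlocks (z ^ n • 1) 0 0 ((z ^ n)⁻¹ • 1)

/-- The normalized solution `Y diag (z^{-n}, z^n)`, which tends to the identity at infinity. -/
noncomputable def normalized (n : ℕ) (Y : ℂ → BlockMat N) (z : ℂ) : BlockMat N :=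
  Y z * Matrix.fromBlocks ((z ^ n)⁻¹ • (1 : Mat N)) 0 0 (z ^ n • (1 : Mat N))

theorem eq_normalized_mul_powDiag (n : ℕ) (Y : ℂ → BlockMat N) {z : ℂ} (hz : z ≠ 0) :
    Y z = normalized n Y z * powDiag N n z := by
  have h := pow_ne_zero n hz
  simp [normalized, powDiag, Matrix.mul_assoc, Matrix.fromBlocks_multiply, smul_smul, h]

theorem adj_powDiag (n : ℕ) (z : ℂ) : adj (powDiag N n) z = powDiag N n z := by
  simp [adj, powDiag, Matrix.fromBlocks_conjTranspose]

theorem adj_eq_powDiag_mul (n : ℕ) (Y : ℂ → BlockMat N) {z : ℂ} (hz : z ≠ 0) :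
    adj Y z = powDiag N n z * adj (normalized n Y) z := by
  rw [← adj_powDiag n z]
  simp only [adj]
  rw [eq_normalized_mul_powDiag n Y (by simpa using hz), Matrix.conjTranspose_mul]

/-- Passing through J inverts diag(z^n, z^{-n}), because the two blocks trade places. -/
theorem powDiag_mul_diag_mul_swapMat (n : ℕ) {z : ℂ} (hz : z ≠ 0) (a b : Mat N) :
    powDiag N n z * Matrix.fromBlocks a 0 0 b * swapMat N * powDiag N n z
      = Matrix.fromBlocks a 0 0 b * swapMat N := by
  have h := pow_ne_zero n hz
  simp [powDiag, Matrix.fromBlocks_multiply, smul_smul, h]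

/-- J Y^* J stands in for Y⁻¹. The powers of z in Y and Y^* cancel across the diagonal matrix, which
leaves only the factors that are bounded at infinity. -/
theorem conj_diag_eq_normalized (n : ℕ) (Y : ℂ → BlockMat N) {z : ℂ} (hz : z ≠ 0) (a b : Mat N) :
    Y z * Matrix.fromBlocks a 0 0 b * swapMat N * adj Y z * swapMat N
      = normalized n Y z * Matrix.fromBlocks a 0 0 b *
        (swapMat N * adj (normalized n Y) z * swapMat N) := by
  rw [adj_eq_powDiag_mul n Y hz, eq_normalized_mul_powDiag n Y hz]
  have := powDiag_mul_diag_mul_swapMat n hz a b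
  simp only [Matrix.mul_assoc] at this ⊢
  rw [← Matrix.mul_assoc (powDiag N n z) (adj _ z), ← Matrix.mul_assoc (swapMat N) (_ * _),
    ← Matrix.mul_assoc (Matrix.fromBlocks a 0 0 b) (_ * _)]
  rw [← Matrix.mul_assoc (powDiag N n z) (_ * _)]
  rw [← Matrix.mul_assoc (swapMat N), ← Matrix.mul_assoc (Matrix.fromBlocks a 0 0 b),
    ← Matrix.mul_assoc (powDiag N n z), this]
  simp only [Matrix.mul_assoc]

/-- `diag (G, -G^*)` for a matrix polynomial `G`. -/
noncomputable def diagPoly (G : (Mat N)[X]) (z : ℂ) : BlockMat N :=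
  Matrix.fromBlocks (pval G z) 0 0 (-adj (pval G) z)

/-- The polynomial part at infinity of `Y diag (G, -G^*) Y⁻¹`, in terms of the asymptotic
coefficients of `Y`. -/
noncomputable def polyPart (c : ℕ → BlockMat N) (G : (Mat N)[X]) (z : ℂ) : BlockMat N :=
  ∑ p ∈ Finset.range (G.natDegree + 1), ∑ l ∈ Finset.range (p + 1), ∑ k ∈ Finset.range (p + 1),
    if l + k ≤ p then z ^ (p - l - k) •
      (c l * Matrix.fromBlocks (G.coeff p) 0 0 (-(G.coeff p)ᴴ) * (swapMat N * (c k)ᴴ * swapMat N))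
    else 0

theorem entire_polyPart (c : ℕ → BlockMat N) (G : (Mat N)[X]) : Entire (polyPart c G) := by
  refine Entire.sum fun p _ => Entire.sum fun l _ => Entire.sum fun k _ => ?_
  split_ifs
  · exact Entire.smul (by fun_prop) (entire_const _)
  · exact entire_const _

theorem diagPoly_eq_sum (G : (Mat N)[X]) (z : ℂ) :
    diagPoly G z = ∑ p ∈ Finset.range (G.natDegree + 1),
      z ^ p • Matrix.fromBlocks (G.coeff p) 0 0 (-(G.coeff p)ᴴ) := by
  rw [diagPoly, adj_pval]
  ext i j
  rcases i with i | i <;> rcases j with j | j <;> simp [pval, Matrix.sum_apply]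

/-- J U^* J has the expansion with coefficients J c_k^* J, so `HasExpansion.pow_smul_mul` applies to
each monomial of G separately. -/
theorem matO_conj_diagPoly {U : ℂ → BlockMat N} {c : ℕ → BlockMat N} (hU : HasExpansion U c)
    (G : (Mat N)[X]) :
    MatO (fun z => U z * diagPoly G z * (swapMat N * adj U z * swapMat N) - polyPart c G z)
      fun z => z⁻¹ := by
  have hV := (hU.adj.const_mul (swapMat N)).mul_const (swapMat N)
  refine (MatO.sum (s := Finset.range (G.natDegree + 1)) fun p _ =>
    (hU.mul_const (Matrix.fromBlocks (G.coeff p) 0 0 (-(G.coeff p)ᴴ))).pow_smul_mul hV p).congr ?_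
  refine Eventually.of_forall fun z => ?_
  rw [diagPoly_eq_sum, Finset.sum_sub_distrib, polyPart]
  congr 1
  rw [Matrix.mul_sum, Matrix.sum_mul]
  exact Finset.sum_congr rfl fun p _ => by simp only [Matrix.mul_smul, Matrix.smul_mul]

end

section

/-! ### The Riemann–Hilbert problem -/

variable {N : ℕ}

theorem IsRHSolution.exists_expansion {W : ℝ → Mat N} {n : ℕ} {Y : ℂ → BlockMat N}
    (hY : IsRHSolution W n Y) :
    ∃ c : ℕ → BlockMat N, c 0 = 1 ∧ HasExpansion (normalized n Y) c := by
  obtain ⟨c, hc⟩ := hY.asymptotics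
  refine ⟨fun l => if l = 0 then 1 else c l, if_pos rfl, fun m i j => (hc m i j).congr_left
    fun z => ?_⟩
  have : ∑ l ∈ Finset.range (m + 1), (z ^ l)⁻¹ • (if l = 0 then 1 else c l)
      = 1 + ∑ l ∈ Finset.Icc 1 m, (z ^ l)⁻¹ • c l := by
    rw [Finset.range_eq_Ico, Finset.sum_eq_sum_Ico_succ_bot (Nat.succ_pos m)]
    simp only [pow_zero, inv_one, if_true, one_smul]
    congr 1
    refine Finset.sum_congr (by ext; simp) fun l hl => ?_
    rw [if_neg (by simp at hl; omega)]
  change _ = (normalized n Y z -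
    ∑ l ∈ Finset.range (m + 1), (z ^ l)⁻¹ • (if l = 0 then 1 else c l)) i j
  rw [this]
  rfl

theorem differentiableOn_normalized {n : ℕ} {Y : ℂ → BlockMat N}
    (hY : ∀ i j, DifferentiableOn ℂ (fun z => Y z i j) {z : ℂ | z.im ≠ 0}) (i j) :
    DifferentiableOn ℂ (fun z => normalized n Y z i j) {z : ℂ | z.im ≠ 0} := by
  simp only [normalized, Matrix.mul_apply]
  refine DifferentiableOn.fun_sum fun k _ => (hY i k).mul ?_
  have hz : ∀ z : ℂ, z.im ≠ 0 → z ^ n ≠ 0 := fun z hz => pow_ne_zero _ fun h => hz (by simp [h])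
  rcases k with k | k <;> rcases j with j | j
  · simp only [Matrix.fromBlocks_apply₁₁, Matrix.smul_apply, smul_eq_mul]
    exact (DifferentiableOn.inv (by fun_prop) hz).mul_const _
  · simp
  · simp
  · simp only [Matrix.fromBlocks_apply₂₂, Matrix.smul_apply, smul_eq_mul]
    fun_prop

/-- The data of a factorized weight: `W = T T^*` on the real line and `T' = G T`. -/
structure IsFactorization (W : ℝ → Mat N) (T : ℂ → Mat N) (G : (Mat N)[X]) : Prop where
  entire : Entire T
  isUnit : ∀ z, IsUnit (T z)
  matDeriv_eq : ∀ z, matDeriv T z = pval G z * T z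
  weight_eq : ∀ x : ℝ, W x = T x * (T x)ᴴ

theorem isUnit_adj {T : ℂ → Mat N} (hu : ∀ z, IsUnit (T z)) (z : ℂ) : IsUnit (adj T z) :=
  (hu _).star

theorem entire_Vmat {T : ℂ → Mat N} (hT : Entire T) (hu : ∀ z, IsUnit (T z)) :
    Entire (Vmat T) :=
  entire_fromBlocks hT (entire_const 0) (entire_const 0) (hT.adj.nonsing_inv (isUnit_adj hu))

theorem mul_inv_of_isUnit {A : Mat N} (h : IsUnit A) : A * A⁻¹ = 1 :=
  Matrix.mul_nonsing_inv _ ((Matrix.isUnit_iff_isUnit_det _).1 h)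

theorem inv_mul_of_isUnit {A : Mat N} (h : IsUnit A) : A⁻¹ * A = 1 :=
  Matrix.nonsing_inv_mul _ ((Matrix.isUnit_iff_isUnit_det _).1 h)

theorem adj_Vmat (T : ℂ → Mat N) (z : ℂ) :
    adj (Vmat T) z = Matrix.fromBlocks (adj T z) 0 0 (T z)⁻¹ := by
  simp [adj, Vmat, Matrix.fromBlocks_conjTranspose, Matrix.conjTranspose_nonsing_inv]

/-- V preserves the form J; this is the reason for taking T^{-*} as its second block. -/
theorem Vmat_swapMat_adj {T : ℂ → Mat N} (hu : ∀ z, IsUnit (T z)) (z : ℂ) :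
    Vmat T z * swapMat N * adj (Vmat T) z = swapMat N := by
  rw [adj_Vmat]
  simp [Vmat, Matrix.fromBlocks_multiply, mul_inv_of_isUnit (hu z),
    inv_mul_of_isUnit (isUnit_adj hu z)]

/-- Differentiate T^* T^{-*} = 1 and use (T^*)' = T^* G^*. This is the source of the block -G^* in
`diagPoly`. -/
theorem IsFactorization.matDeriv_adj_inv {W : ℝ → Mat N} {T : ℂ → Mat N} {G : (Mat N)[X]}
    (h : IsFactorization W T G) (z : ℂ) :
    matDeriv (fun w => (adj T w)⁻¹) z = -adj (pval G) z * (adj T z)⁻¹ := by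
  have hu := isUnit_adj h.isUnit
  have h1 := (h.entire.adj.hasMatDerivAt z).mul
    ((h.entire.adj.nonsing_inv hu).hasMatDerivAt z)
  have h2 := h1.unique ((hasMatDerivAt_const 1 z).congr
    (Eventually.of_forall fun w => mul_inv_of_isUnit (hu w)))
  have h3 : matDeriv (adj T) z = adj T z * adj (pval G) z := by
    rw [h.entire.matDeriv_adj]
    simp only [adj, h.matDeriv_eq, Matrix.conjTranspose_mul]
  rw [h3] at h2
  have h4 := congrArg ((adj T z)⁻¹ * ·) h2
  simp only [Matrix.mul_add, ← Matrix.mul_assoc, inv_mul_of_isUnit (hu z), Matrix.one_mul,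
    Matrix.mul_zero] at h4
  rw [Matrix.neg_mul]
  exact eq_neg_of_add_eq_zero_right h4

theorem IsFactorization.matDeriv_Vmat {W : ℝ → Mat N} {T : ℂ → Mat N} {G : (Mat N)[X]}
    (h : IsFactorization W T G) (z : ℂ) :
    matDeriv (Vmat T) z = diagPoly G z * Vmat T z := by
  have e : diagPoly G z * Vmat T z
      = Matrix.fromBlocks (matDeriv T z) 0 0 (matDeriv (fun w => (adj T w)⁻¹) z) := by
    rw [h.matDeriv_adj_inv, h.matDeriv_eq]
    simp [diagPoly, Vmat, Matrix.fromBlocks_multiply]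
  rw [e]
  ext i j
  rcases i with i | i <;> rcases j with j | j <;> simp [matDeriv, Vmat]

/-- The matrix `X`, continued across the real line with the help of its constant jump. -/
theorem IsFactorization.exists_entire_Xmat {W : ℝ → Mat N} {T : ℂ → Mat N} {G : (Mat N)[X]}
    (h : IsFactorization W T G) {n : ℕ} {Y : ℂ → BlockMat N} (hY : IsRHSolution W n Y) :
    ∃ E : ℂ → BlockMat N, Entire E ∧ (∀ z : ℂ, 0 < z.im → E z = Xmat Y T z) ∧
      ∀ z : ℂ, z.im < 0 → E z = Xmat Y T z * jumpMat N := by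
  classical
  obtain ⟨Yp, Ym, hYp, hYm, htp, htm, hjump⟩ := hY.jump
  have hV := entire_Vmat h.entire h.isUnit
  have hVc : Continuous (Vmat T) := continuous_matrix fun i j => (hV i j).continuous
  have hVr : Continuous fun x : ℝ => Vmat T x := hVc.comp Complex.continuous_ofReal
  have hXd : ∀ i j, DifferentiableOn ℂ (fun z => Xmat Y T z i j) {z : ℂ | z.im ≠ 0} := by
    intro i j
    simp only [Xmat, Matrix.mul_apply]
    exact DifferentiableOn.fun_sum fun k _ => (hY.analytic i k).mul (hV k j).differentiableOn
  have hXKd : ∀ i j, DifferentiableOn ℂ (fun z => (Xmat Y T z * jumpMat N) i j)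
      {z : ℂ | z.im ≠ 0} := by
    intro i j
    simp only [Matrix.mul_apply]
    exact DifferentiableOn.fun_sum fun k _ => (hXd i k).mul_const _
  -- The jump of X is constant, so multiplying by it in the lower half plane makes the boundary
  -- values from both sides agree.
  set Z : ℂ → BlockMat N := fun z => if 0 < z.im then Xmat Y T z else Xmat Y T z * jumpMat N
    with hZ
  have hZp : ∀ z : ℂ, 0 < z.im → Z z = Xmat Y T z := fun z hz => by simp [hZ, hz]
  have hZm : ∀ z : ℂ, z.im < 0 → Z z = Xmat Y T z * jumpMat N := fun z hz => by
    simp [hZ, not_lt.2 hz.le]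
  have hZd : ∀ i j, DifferentiableOn ℂ (fun z => Z z i j) {z : ℂ | z.im ≠ 0} := by
    intro i j z hz
    rcases lt_or_gt_of_ne (show z.im ≠ 0 from hz) with hz' | hz'
    · refine DifferentiableAt.differentiableWithinAt ?_
      refine ((hXKd i j).differentiableAt (isOpen_im_ne_zero.mem_nhds hz)).congr_of_eventuallyEq ?_
      filter_upwards [(isOpen_lt Complex.continuous_im continuous_const).mem_nhds hz'] with w hw
      rw [hZm w hw]
    · refine DifferentiableAt.differentiableWithinAt ?_
      refine ((hXd i j).differentiableAt (isOpen_im_ne_zero.mem_nhds hz)).congr_of_eventuallyEq ?_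
      filter_upwards [isOpen_im_pos.mem_nhds hz'] with w hw
      rw [hZp w hw]
  have hVj : ∀ x : ℝ, Matrix.fromBlocks 1 (W x) 0 1 * Vmat T x = Vmat T x * jumpMat N := by
    intro x
    have h1 : W x * (adj T x)⁻¹ = T x := by
      rw [h.weight_eq, ← adj_ofReal, Matrix.mul_assoc, mul_inv_of_isUnit (isUnit_adj h.isUnit _),
        Matrix.mul_one]
    simp [Vmat, Matrix.fromBlocks_multiply, h1]
  have hent : ∀ i j, ∃ F : ℂ → ℂ, Differentiable ℂ F ∧ ∀ z : ℂ, z.im ≠ 0 → F z = Z z i j := by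
    intro i j
    refine exists_entire_extension (g := fun x => (Yp x * Vmat T x) i j) (hZd i j) ?_ ?_ ?_
    · exact (hYp.mul hVr).matrix_elem i j
    · intro x
      have h1 : Tendsto (Xmat Y T) (𝓝[{z : ℂ | 0 < z.im}] (x : ℂ)) (𝓝 (Yp x * Vmat T x)) :=
        (htp x).mul ((hVc.tendsto _).mono_left nhdsWithin_le_nhds)
      have h2 := ((continuous_id.matrix_elem i j).tendsto _).comp h1
      exact h2.congr' (eventually_nhdsWithin_of_forall fun z hz => by simp [hZp z hz])
    · intro x
      have h1 : Tendsto (fun z => Xmat Y T z * jumpMat N) (𝓝[{z : ℂ | z.im < 0}] (x : ℂ))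
          (𝓝 (Ym x * Vmat T x * jumpMat N)) :=
        ((htm x).mul ((hVc.tendsto _).mono_left nhdsWithin_le_nhds)).mul_const _
      rw [Matrix.mul_assoc, ← hVj, ← Matrix.mul_assoc, ← hjump] at h1
      have h2 := ((continuous_id.matrix_elem i j).tendsto _).comp h1
      exact h2.congr' (eventually_nhdsWithin_of_forall fun z hz => by simp [hZm z hz])
  choose F hFd hF using hent
  refine ⟨fun z => Matrix.of fun i j => F i j z, fun i j => hFd i j, fun z hz => ?_, fun z hz => ?_⟩
  · ext i j
    exact (hF i j z hz.ne').trans (by rw [hZp z hz])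
  · ext i j
    exact (hF i j z hz.ne).trans (by rw [hZm z hz])

/-- Bilinear expressions in functions with the jump of `X` have no jump. -/
theorem exists_entire_sandwich {E₁ E₂ X₁ X₂ : ℂ → BlockMat N} (h₁ : Entire E₁) (h₂ : Entire E₂)
    (hp₁ : ∀ z : ℂ, 0 < z.im → E₁ z = X₁ z) (hm₁ : ∀ z : ℂ, z.im < 0 → E₁ z = X₁ z * jumpMat N)
    (hp₂ : ∀ z : ℂ, 0 < z.im → E₂ z = X₂ z) (hm₂ : ∀ z : ℂ, z.im < 0 → E₂ z = X₂ z * jumpMat N) :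
    ∃ M : ℂ → BlockMat N, Entire M ∧
      ∀ z : ℂ, z.im ≠ 0 → M z = X₁ z * swapMat N * adj X₂ z * swapMat N := by
  -- The operation `adj` exchanges the half planes, so at each point exactly one of E₁ and `adj E₂`
  -- carries a jump factor. In the lower half plane `jumpInv` cancels the factor of E₁; in the upper
  -- one `jumpInv_swapMat_jumpMat` absorbs the factor of `adj E₂`.
  refine ⟨fun z => E₁ z * (jumpInv N * swapMat N) * adj E₂ z * swapMat N,
    ((h₁.mul (entire_const _)).mul h₂.adj).mul (entire_const _), fun z hz => ?_⟩
  rcases lt_or_gt_of_ne hz with hz' | hz'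
  · have e : adj E₂ z = adj X₂ z := by
      rw [adj, adj, hp₂ _ (by simpa using hz')]
    have h := jumpMat_mul_jumpInv N
    simp only [hm₁ z hz', e, Matrix.mul_assoc]
    rw [← Matrix.mul_assoc (jumpMat N), h, Matrix.one_mul]
  · have e : adj E₂ z = (jumpMat N)ᴴ * adj X₂ z := by
      rw [adj, adj, hm₂ _ (by simpa using hz'), Matrix.conjTranspose_mul]
    have h := jumpInv_swapMat_jumpMat N
    simp only [hp₁ z hz', e, Matrix.mul_assoc] at h ⊢
    rw [← Matrix.mul_assoc (swapMat N) ((jumpMat N)ᴴ), ← Matrix.mul_assoc (jumpInv N), h]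

end

/-! ### Symmetry of X and its differential equation -/

section

variable {N : ℕ}

theorem adj_Xmat (Y : ℂ → BlockMat N) (T : ℂ → Mat N) (z : ℂ) :
    adj (Xmat Y T) z = adj (Vmat T) z * adj Y z :=
  adj_mul Y (Vmat T) z

/-- By V J V^* = J the factor V disappears, so T, which may grow arbitrarily at infinity, plays no
part in the asymptotic estimates. -/
theorem Xmat_sandwich {T : ℂ → Mat N} (hu : ∀ z, IsUnit (T z)) (Y : ℂ → BlockMat N)
    (A : BlockMat N) (z : ℂ) :
    A * Vmat T z * swapMat N * adj (Xmat Y T) z * swapMat N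
      = A * swapMat N * adj Y z * swapMat N := by
  have h := Vmat_swapMat_adj hu z
  rw [adj_Xmat]
  simp only [Matrix.mul_assoc] at h ⊢
  rw [← Matrix.mul_assoc (adj (Vmat T) z) (adj Y z), ← Matrix.mul_assoc (swapMat N) (_ * _),
    ← Matrix.mul_assoc (Vmat T z) (_ * _), ← Matrix.mul_assoc (swapMat N) (adj (Vmat T) z),
    ← Matrix.mul_assoc (Vmat T z) (_ * _), h, Matrix.mul_assoc]

variable {W : ℝ → Mat N} {T : ℂ → Mat N} {G : (Mat N)[X]} {n : ℕ} {Y : ℂ → BlockMat N}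
  {c : ℕ → BlockMat N}

/-- This produces the inverse of X, namely J X^* J, without a determinant argument. The product has
no jump, so it is entire. At infinity it equals U J U^* J with U normalized, hence 1 + O(1/z), and
Liouville finishes. -/
theorem IsFactorization.Xmat_symm (h : IsFactorization W T G) (hY : IsRHSolution W n Y)
    (hc₀ : c 0 = 1) (hc : HasExpansion (normalized n Y) c) {z : ℂ} (hz : z.im ≠ 0) :
    Xmat Y T z * swapMat N * adj (Xmat Y T) z * swapMat N = 1 := by
  obtain ⟨E, hE, hEp, hEm⟩ := h.exists_entire_Xmat hY
  obtain ⟨M, hM, hMX⟩ := exists_entire_sandwich hE hE hEp hEm hEp hEm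
  rw [← hMX z hz]
  have hV := (hc.adj.const_mul (swapMat N)).mul_const (swapMat N)
  have hO := hc.pow_smul_mul hV 0
  simp only [pow_zero, one_smul, zero_add, Finset.range_one, Finset.sum_singleton, le_refl, if_true,
    Nat.sub_zero, hc₀, Matrix.conjTranspose_one, Matrix.mul_one, swapMat_mul_self] at hO
  refine sub_eq_zero.1 ((hM.sub (entire_const 1)).eq_zero_of_matO ?_ z)
  refine MatO.trans (hO.congr ?_) isBigO_inv_complex_inv_im
  filter_upwards [eventually_offReal_im_ne_zero, eventually_offReal_ne_zero] with w hw hw0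
  have e := conj_diag_eq_normalized n Y hw0 (1 : Mat N) 1
  rw [Matrix.fromBlocks_one, Matrix.mul_one, Matrix.mul_one] at e
  rw [hMX w hw, ← e]
  congr 1
  exact (Xmat_sandwich h.isUnit Y (Y w) w).symm

theorem hasMatDerivAt_of_differentiableOn {F : ℂ → BlockMat N}
    (hF : ∀ i j, DifferentiableOn ℂ (fun z => F z i j) {z : ℂ | z.im ≠ 0}) {z : ℂ}
    (hz : z.im ≠ 0) : HasMatDerivAt F (matDeriv F z) z := fun i j =>
  ((hF i j).differentiableAt (isOpen_im_ne_zero.mem_nhds hz)).hasDerivAt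

theorem hasMatDerivAt_powDiag (n : ℕ) {z : ℂ} (hz : z ≠ 0) :
    HasMatDerivAt (powDiag N n)
      (((n : ℂ) * z⁻¹) • (Matrix.fromBlocks 1 0 0 (-1) * powDiag N n z)) z := by
  have h1 : HasDerivAt (fun w : ℂ => w ^ n) ((n : ℂ) * z⁻¹ * z ^ n) z := by
    refine (hasDerivAt_pow n z).congr_deriv ?_
    rcases n with _ | n
    · simp
    · rw [Nat.add_sub_cancel, pow_succ]; field_simp
  have h2 : HasDerivAt (fun w : ℂ => (w ^ n)⁻¹) (-((n : ℂ) * z⁻¹ * (z ^ n)⁻¹)) z := by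
    refine (h1.inv (pow_ne_zero n hz)).congr_deriv ?_
    have := pow_ne_zero n hz
    field_simp
  rintro (i | i) (j | j)
  · simpa [powDiag, Matrix.fromBlocks_multiply, mul_assoc] using h1.mul_const ((1 : Mat N) i j)
  · simpa [powDiag, Matrix.fromBlocks_multiply] using hasDerivAt_const z (0 : ℂ)
  · simpa [powDiag, Matrix.fromBlocks_multiply] using hasDerivAt_const z (0 : ℂ)
  · simpa [powDiag, Matrix.fromBlocks_multiply, mul_assoc] using h2.mul_const ((1 : Mat N) i j)

theorem IsFactorization.hasMatDerivAt_Xmat (h : IsFactorization W T G) (hY : IsRHSolution W n Y)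
    {z : ℂ} (hz : z.im ≠ 0) :
    HasMatDerivAt (Xmat Y T) ((matDeriv Y z + Y z * diagPoly G z) * Vmat T z) z := by
  have := (hasMatDerivAt_of_differentiableOn hY.analytic hz).mul
    ((entire_Vmat h.entire h.isUnit).hasMatDerivAt z)
  rwa [h.matDeriv_Vmat, ← Matrix.mul_assoc, ← Matrix.add_mul] at this

theorem matDeriv_eq_normalized
    (hY : ∀ i j, DifferentiableOn ℂ (fun z => Y z i j) {z : ℂ | z.im ≠ 0}) {z : ℂ}
    (hz : z.im ≠ 0) :
    matDeriv Y z = (matDeriv (normalized n Y) z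
      + ((n : ℂ) * z⁻¹) • (normalized n Y z * Matrix.fromBlocks 1 0 0 (-1))) * powDiag N n z := by
  have hz0 : z ≠ 0 := fun h => hz (by simp [h])
  have h1 := (hasMatDerivAt_of_differentiableOn (differentiableOn_normalized (n := n) hY) hz).mul
    (hasMatDerivAt_powDiag n hz0)
  have h2 := h1.congr (F₁ := Y) ?_
  · rw [h2.matDeriv_eq, Matrix.add_mul, Matrix.smul_mul, Matrix.mul_smul, Matrix.mul_assoc]
  · filter_upwards [isOpen_im_ne_zero.mem_nhds hz] with w hw
    exact eq_normalized_mul_powDiag n Y fun h => hw (by simp [h])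

/-- The differential equation for `X`. -/
theorem IsFactorization.hasMatDerivAt_Xmat_polyPart (h : IsFactorization W T G)
    (hY : IsRHSolution W n Y) (hc₀ : c 0 = 1) (hc : HasExpansion (normalized n Y) c) {z : ℂ}
    (hz : z.im ≠ 0) :
    HasMatDerivAt (Xmat Y T) (polyPart c G z * Xmat Y T z) z := by
  obtain ⟨E, hE, hEp, hEm⟩ := h.exists_entire_Xmat hY
  have hX := fun w (hw : w.im ≠ 0) => h.hasMatDerivAt_Xmat hY (z := w) hw
  have hE'p : ∀ w : ℂ, 0 < w.im → matDeriv E w = matDeriv (Xmat Y T) w := fun w hw => by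
    rw [(hX w hw.ne').matDeriv_eq]
    refine ((hX w hw.ne').congr ?_).matDeriv_eq
    filter_upwards [isOpen_im_pos.mem_nhds hw] with v hv using hEp v hv
  have hE'm : ∀ w : ℂ, w.im < 0 → matDeriv E w = matDeriv (Xmat Y T) w * jumpMat N := fun w hw => by
    have h1 := (hX w hw.ne).mul (hasMatDerivAt_const (jumpMat N) w)
    rw [Matrix.mul_zero, add_zero] at h1
    rw [(hX w hw.ne).matDeriv_eq]
    refine (h1.congr ?_).matDeriv_eq
    filter_upwards [(isOpen_lt Complex.continuous_im continuous_const).mem_nhds hw] with v hv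
      using hEm v hv
  -- Since the jump matrix is constant, X' has the same jump as X, and X' J X^* J extends to an
  -- entire function.
  obtain ⟨M, hM, hMX⟩ := exists_entire_sandwich hE.matDeriv hE hE'p hE'm hEp hEm
  set U := normalized n Y with hU
  set B : ℂ → BlockMat N := fun w => swapMat N * adj U w * swapMat N with hB
  have hB1 : MatO B fun _ => 1 := ((hc.adj.const_mul _).mul_const (swapMat N)).matO_one
  have hMU : ∀ w : ℂ, w.im ≠ 0 → M w = matDeriv U w * B w
      + ((n : ℂ) * w⁻¹) • (U w * Matrix.fromBlocks 1 0 0 (-1) * B w)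
      + U w * diagPoly G w * B w := by
    intro w hw
    have hw0 : w ≠ 0 := fun h => hw (by simp [h])
    rw [hMX w hw, (hX w hw).matDeriv_eq, Xmat_sandwich h.isUnit, matDeriv_eq_normalized (n := n)
      hY.analytic hw, Matrix.add_mul, Matrix.add_mul, Matrix.add_mul, diagPoly,
      conj_diag_eq_normalized n Y hw0, adj_eq_powDiag_mul n Y hw0]
    congr 1
    have e := powDiag_mul_diag_mul_swapMat n hw0 (1 : Mat N) 1
    rw [Matrix.fromBlocks_one, Matrix.mul_one, Matrix.one_mul] at e
    have e' : ∀ Q R : BlockMat N, Q * powDiag N n w * swapMat N * (powDiag N n w * R) * swapMat N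
        = Q * (swapMat N * R * swapMat N) := fun Q R => by
      calc _ = Q * ((powDiag N n w * swapMat N * powDiag N n w) * R * swapMat N) := by
            simp only [Matrix.mul_assoc]
        _ = _ := by rw [e]
    rw [e', Matrix.add_mul, Matrix.smul_mul]
  -- U is bounded near infinity only off the real line, so the discs in Cauchy's estimate shrink
  -- with the distance to that line. Hence the bound 1/|Im w| in place of a power of 1/w.
  have hder : MatO (fun w => matDeriv U w * B w) fun w => (w.im : ℂ)⁻¹ := by
    have h1 : MatO (matDeriv U) fun w => (w.im : ℂ)⁻¹ := fun i j =>
      isBigO_deriv_inv_im (differentiableOn_normalized hY.analytic i j) (hc.matO_one i j)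
    simpa using h1.mul hB1
  have hpow : MatO (fun w => ((n : ℂ) * w⁻¹) • (U w * Matrix.fromBlocks 1 0 0 (-1) * B w))
      fun w => (w.im : ℂ)⁻¹ := by
    have h1 := MatO.smul ((Asymptotics.isBigO_refl (fun w : ℂ => w⁻¹) offReal).const_mul_left n)
      ((hc.matO_one.mul_const (Matrix.fromBlocks 1 0 0 (-1))).mul hB1)
    simp only [mul_one] at h1
    exact h1.trans isBigO_inv_complex_inv_im
  have hM0 : M z = polyPart c G z := by
    refine sub_eq_zero.1 ((hM.sub (entire_polyPart c G)).eq_zero_of_matO ?_ z)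
    refine ((hder.add hpow).add ((matO_conj_diagPoly hc G).trans isBigO_inv_complex_inv_im)).congr ?_
    filter_upwards [eventually_offReal_im_ne_zero] with w hw
    rw [hMU w hw]
    abel
  have hsymm := h.Xmat_symm hY hc₀ hc hz
  rw [← hM0, hMX z hz]
  have e : matDeriv (Xmat Y T) z * swapMat N * adj (Xmat Y T) z * swapMat N * Xmat Y T z
      = matDeriv (Xmat Y T) z := by
    simp only [Matrix.mul_assoc] at hsymm ⊢
    have := mul_eq_one_comm.1 hsymm
    simp only [Matrix.mul_assoc] at this
    rw [this, Matrix.mul_one]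
  rw [e, (hX z hz).matDeriv_eq]
  exact hX z hz

/-- Multiplication of `X` by `diag (A, A)` on the right, for entire `A` with `A^* = -A`. -/
theorem IsFactorization.polyPart_mul_Xmat (h : IsFactorization W T G)
    (hY : IsRHSolution W n Y) (hc₀ : c 0 = 1) (hc : HasExpansion (normalized n Y) c)
    {A : ℂ → Mat N} (hA : Entire A) (hA' : ∀ z, adj A z = -A z) {H : (Mat N)[X]}
    (hH : ∀ z, pval H z * T z = T z * A z) {z : ℂ} (hz : z.im ≠ 0) :
    polyPart c H z * Xmat Y T z = Xmat Y T z * Matrix.fromBlocks (A z) 0 0 (A z) := by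
  obtain ⟨E, hE, hEp, hEm⟩ := h.exists_entire_Xmat hY
  have hAd : Entire fun z => Matrix.fromBlocks (A z) 0 0 (A z) :=
    entire_fromBlocks hA (entire_const 0) (entire_const 0) hA
  -- A block diagonal matrix with equal blocks commutes with `jumpMat`, so X diag(A, A) has the same
  -- jump as X.
  obtain ⟨M, hM, hMX⟩ := exists_entire_sandwich
    (X₁ := fun z => Xmat Y T z * Matrix.fromBlocks (A z) 0 0 (A z)) (hE.mul hAd) hE
    (fun w hw => by simp only [hEp w hw])
    (fun w hw => by
      simp only [hEm w hw, Matrix.mul_assoc]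
      congr 1
      simp [Matrix.fromBlocks_multiply]) hEp hEm
  -- The upper block is the hypothesis H T = T A. The lower one is its adjoint, where A^* = -A
  -- supplies the sign of -H^*.
  have hcomm : ∀ w, Vmat T w * Matrix.fromBlocks (A w) 0 0 (A w) = diagPoly H w * Vmat T w := by
    intro w
    have hu := isUnit_adj h.isUnit w
    have h1 : -A w * adj T w = adj T w * adj (pval H) w := by
      have := congrArg Matrix.conjTranspose (hH (starRingEnd ℂ w))
      rw [Matrix.conjTranspose_mul, Matrix.conjTranspose_mul] at this
      rw [← hA']
      exact this.symm
    have h2 : (adj T w)⁻¹ * A w = -adj (pval H) w * (adj T w)⁻¹ := by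
      have h3 : adj (pval H) w = (adj T w)⁻¹ * (-A w * adj T w) := by
        rw [h1, ← Matrix.mul_assoc, inv_mul_of_isUnit hu, Matrix.one_mul]
      rw [h3, Matrix.neg_mul, Matrix.neg_mul, Matrix.mul_neg, Matrix.neg_mul, neg_neg,
        Matrix.mul_assoc, Matrix.mul_assoc, mul_inv_of_isUnit hu, Matrix.mul_one]
    simp [Vmat, diagPoly, Matrix.fromBlocks_multiply, hH w, h2]
  have hM0 : M z = polyPart c H z := by
    refine sub_eq_zero.1 ((hM.sub (entire_polyPart c H)).eq_zero_of_matO ?_ z)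
    refine ((matO_conj_diagPoly hc H).trans isBigO_inv_complex_inv_im).congr ?_
    filter_upwards [eventually_offReal_im_ne_zero, eventually_offReal_ne_zero] with w hw hw0
    rw [hMX w hw, Xmat, Matrix.mul_assoc (Y w), hcomm, ← Matrix.mul_assoc (Y w),
      Xmat_sandwich h.isUnit, diagPoly, conj_diag_eq_normalized n Y hw0]
  have hsymm := h.Xmat_symm hY hc₀ hc hz
  rw [← hM0, hMX z hz]
  simp only [Matrix.mul_assoc] at hsymm ⊢
  have := mul_eq_one_comm.1 hsymm
  simp only [Matrix.mul_assoc] at this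
  rw [this, Matrix.mul_one]

end

section

/-! ### Moments -/

variable {N : ℕ}

/-- The moment `∫ x^k F(x) W(x) dx`. -/
noncomputable def moment (W : ℝ → Mat N) (F : ℂ → Mat N) (k : ℕ) : Mat N :=
  matIntegral fun x : ℝ => ((x : ℂ) ^ k) • (F x * W x)

section

variable {W : ℝ → Mat N} (hW : IsWeight W)
include hW

theorem IsWeight.integrable_pow (k : ℕ) (i j : Fin N) :
    Integrable fun x : ℝ => (x : ℂ) ^ k * W x i j := by
  have hc : Continuous fun x : ℝ => (x : ℂ) ^ k * W x i j :=
    (Complex.continuous_ofReal.pow k).mul (hW.smooth i j).continuous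
  refine (hW.moments k i j).mono hc.aestronglyMeasurable (Eventually.of_forall fun x => ?_)
  simp

theorem IsWeight.integrable_moment (Q : (Mat N)[X]) (k : ℕ) (i j : Fin N) :
    Integrable fun x : ℝ => (((x : ℂ) ^ k) • (pval Q x * W x)) i j := by
  have e : (fun x : ℝ => (((x : ℂ) ^ k) • (pval Q x * W x)) i j)
      = fun x : ℝ => ∑ p ∈ Finset.range (Q.natDegree + 1), ∑ m,
        Q.coeff p i m * ((x : ℂ) ^ (k + p) * W x m j) := by
    funext x
    simp only [pval, Matrix.sum_mul, Matrix.smul_mul, Matrix.smul_apply, Matrix.sum_apply,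
      Matrix.mul_apply, smul_eq_mul, Finset.mul_sum]
    refine Finset.sum_congr rfl fun p _ => Finset.sum_congr rfl fun m _ => ?_
    rw [pow_add]; ring
  rw [e]
  exact integrable_finsetSum _ fun p _ => integrable_finsetSum _ fun m _ =>
    (hW.integrable_pow (k + p) m j).const_mul _

theorem IsWeight.wip_eq_sum_moment (Q : (Mat N)[X]) {R : (Mat N)[X]} {n : ℕ}
    (hR : R.natDegree < n) :
    wip W Q R = ∑ k ∈ Finset.range n, moment W (pval Q) k * (R.coeff k)ᴴ := by
  ext i j
  simp only [wip, moment, matIntegral, Matrix.of_apply, Matrix.sum_apply,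
    Matrix.mul_apply (M := Matrix.of _)]
  have e : ∀ x : ℝ, (pval Q x * W x * (pval R x)ᴴ) i j
      = ∑ k ∈ Finset.range n, ∑ m, (((x : ℂ) ^ k) • (pval Q x * W x)) i m * (R.coeff k)ᴴ m j := by
    intro x
    rw [pval_eq_sum_range R hR, Matrix.conjTranspose_sum, Matrix.mul_sum, Matrix.sum_apply]
    refine Finset.sum_congr rfl fun k _ => ?_
    rw [Matrix.conjTranspose_smul, Matrix.mul_smul, ← Matrix.smul_mul, Matrix.mul_apply]
    simp
  simp_rw [e]
  rw [integral_finsetSum _ fun k _ => integrable_finsetSum _ fun m _ =>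
    (hW.integrable_moment Q k i m).mul_const _]
  refine Finset.sum_congr rfl fun k _ => ?_
  rw [integral_finsetSum _ fun m _ => (hW.integrable_moment Q k i m).mul_const _]
  exact Finset.sum_congr rfl fun m _ => integral_mul_const _ _

theorem IsWeight.conjTranspose_wip (Q R : (Mat N)[X]) : (wip W Q R)ᴴ = wip W R Q := by
  ext i j
  simp only [wip, matIntegral, Matrix.conjTranspose_apply, Matrix.of_apply]
  rw [← starRingEnd_apply, ← integral_conj]
  refine integral_congr_ae (Eventually.of_forall fun x => ?_)
  have hWx : (W x)ᴴ = W x := (hW.posDef x).isHermitian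
  have e : pval R x * W x * (pval Q x)ᴴ = (pval Q x * W x * (pval R x)ᴴ)ᴴ := by
    simp [Matrix.conjTranspose_mul, hWx, Matrix.mul_assoc]
  simp only [e, Matrix.conjTranspose_apply, starRingEnd_apply]

theorem IsWeight.moment_add (Q R : (Mat N)[X]) (k : ℕ) :
    moment W (pval Q + pval R) k = moment W (pval Q) k + moment W (pval R) k := by
  ext i j
  simp only [moment, matIntegral, Matrix.add_apply, Matrix.of_apply]
  rw [← integral_add (hW.integrable_moment Q k i j) (hW.integrable_moment R k i j)]
  refine integral_congr_ae (Eventually.of_forall fun x => ?_)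
  simp [Matrix.add_mul, mul_add]

theorem IsWeight.moment_const_mul (A : Mat N) (Q : (Mat N)[X]) (k : ℕ) :
    moment W (fun z => A * pval Q z) k = A * moment W (pval Q) k := by
  ext i j
  simp only [moment, matIntegral, Matrix.mul_apply (N := Matrix.of _), Matrix.of_apply]
  have e : ∀ x : ℝ, (((x : ℂ) ^ k) • (A * pval Q x * W x)) i j
      = ∑ m, A i m * (((x : ℂ) ^ k) • (pval Q x * W x)) m j := by
    intro x
    rw [Matrix.mul_assoc, ← Matrix.mul_smul, Matrix.mul_apply]
  simp_rw [e]
  rw [integral_finsetSum _ fun m _ => (hW.integrable_moment Q k m j).const_mul _]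
  exact Finset.sum_congr rfl fun m _ => integral_const_mul _ _

end

theorem pval_add (Q R : (Mat N)[X]) : pval (Q + R) = pval Q + pval R := by
  funext z
  set n := max (max Q.natDegree R.natDegree) (Q + R).natDegree + 1
  rw [Pi.add_apply, pval_eq_sum_range (Q + R) (n := n) (by omega),
    pval_eq_sum_range Q (n := n) (by omega), pval_eq_sum_range R (n := n) (by omega),
    ← Finset.sum_add_distrib]
  simp

theorem pval_C_mul (A : Mat N) (Q : (Mat N)[X]) : pval (C A * Q) = fun z => A * pval Q z := by
  funext z
  rw [pval_eq_sum_range (C A * Q) (n := Q.natDegree + 1)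
    (Nat.lt_succ_of_le (natDegree_C_mul_le _ _)), pval, Matrix.mul_sum]
  simp

theorem pval_monomial (m : ℕ) (A : Mat N) (z : ℂ) : pval (monomial m A) z = z ^ m • A := by
  rw [pval_eq_sum_range _ (Nat.lt_succ_of_le (natDegree_monomial_le A)),
    Finset.sum_eq_single m]
  · simp
  · intro b _ hb
    simp [coeff_monomial, hb.symm]
  · simp

theorem wip_C_mul {W : ℝ → Mat N} (hW : IsWeight W) (A B : Mat N) (Q R : (Mat N)[X]) :
    wip W (C A * Q) (C B * R) = A * wip W Q R * Bᴴ := by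
  rw [hW.wip_eq_sum_moment (C A * Q) (n := R.natDegree + 1)
    (Nat.lt_succ_of_le (natDegree_C_mul_le _ _)),
    hW.wip_eq_sum_moment Q (Nat.lt_succ_self R.natDegree), Matrix.mul_sum, Matrix.sum_mul]
  refine Finset.sum_congr rfl fun k _ => ?_
  rw [pval_C_mul, hW.moment_const_mul, coeff_C_mul, Matrix.conjTranspose_mul]
  simp only [Matrix.mul_assoc]

section

variable {W : ℝ → Mat N} {P : ℕ → (Mat N)[X]} {κ : ℕ → Mat N} (hW : IsWeight W)
  (hP : IsMonicOrthogonal W P) (hκ : IsNormalizing W P κ)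
include hW hP

theorem moment_eq_zero_of_lt {n k : ℕ} (hk : k < n) : moment W (pval (P n)) k = 0 := by
  have h := (hP n).2.2 (monomial k 1) (lt_of_le_of_lt (natDegree_monomial_le _) hk)
  rw [hW.wip_eq_sum_moment _ (Nat.lt_succ_of_le (natDegree_monomial_le (1 : Mat N))),
    Finset.sum_eq_single k] at h
  · simpa using h
  · intro b _ hb
    simp [coeff_monomial, hb.symm]
  · simp

theorem wip_eq_moment_mul {n : ℕ} {Q : (Mat N)[X]} (hQ : Q.natDegree ≤ n) :
    wip W (P n) Q = moment W (pval (P n)) n * (Q.coeff n)ᴴ := by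
  rw [hW.wip_eq_sum_moment _ (Nat.lt_succ_of_le hQ), Finset.sum_range_succ,
    Finset.sum_eq_zero, zero_add]
  intro k hk
  rw [moment_eq_zero_of_lt hW hP (Finset.mem_range.1 hk), Matrix.zero_mul]

include hκ

/-- Orthonormality reads κ_n h κ_n^* = 1 with h the n-th moment of P_n. For square matrices the
factors may be permuted cyclically, which gives κ_n^* κ_n h = 1. -/
theorem gam_mul_moment (n : ℕ) : gam κ n * moment W (pval (P n)) n = 1 := by
  have h := hκ n n
  rw [if_pos rfl, wip_C_mul hW, wip_eq_moment_mul hW hP (hP n).1, (hP n).2.1,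
    Matrix.conjTranspose_one, Matrix.mul_one, Matrix.mul_assoc] at h
  have h1 := mul_eq_one_comm.1 h
  rw [Matrix.mul_assoc] at h1
  rw [gam]
  exact mul_eq_one_comm.1 h1

/-- A matrix polynomial of degree less than `n` whose first `n` moments vanish is zero. -/
theorem eq_zero_of_moment_eq_zero {n : ℕ} {Q : (Mat N)[X]} (hd : Q.degree < n)
    (hm : ∀ k < n, moment W (pval Q) k = 0) : Q = 0 := by
  by_contra hQ
  have hdn : Q.natDegree < n := (natDegree_lt_iff_degree_lt hQ).2 hd
  set d := Q.natDegree
  -- Q is paired with the monic orthogonal polynomial of its own degree d. The vanishing moments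
  -- make the pairing zero, while orthogonality evaluates its adjoint as an invertible moment times
  -- the adjoint of the leading coefficient of Q.
  have h1 : wip W Q (P d) = 0 := by
    rw [hW.wip_eq_sum_moment _ (Nat.lt_succ_of_le (hP d).1)]
    refine Finset.sum_eq_zero fun k hk => ?_
    rw [hm k (by simp at hk; omega), Matrix.zero_mul]
  have h2 := wip_eq_moment_mul hW hP (le_refl d)
  rw [← hW.conjTranspose_wip, h1, Matrix.conjTranspose_zero] at h2
  have h3 : (Q.coeff d)ᴴ = 0 := by
    rw [← Matrix.one_mul (Q.coeff d)ᴴ, ← gam_mul_moment hW hP hκ d, Matrix.mul_assoc, ← h2,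
      Matrix.mul_zero]
  exact hQ (leadingCoeff_eq_zero.1 (Matrix.conjTranspose_eq_zero.1 h3))

theorem isUnit_gam (n : ℕ) : IsUnit (gam κ n) :=
  IsUnit.of_mul_eq_one _ (gam_mul_moment hW hP hκ n)

end

/-- For natural indices below n the zero convention agrees with orthogonality, so no case
distinction is needed there. -/
theorem bcoef_natCast {W : ℝ → Mat N} {P : ℕ → (Mat N)[X]} (hW : IsWeight W)
    (hP : IsMonicOrthogonal W P) (n k : ℕ) : bcoef W P n k = moment W (pval (P n)) k := by
  by_cases h : n ≤ k
  · simp [bcoef, h, moment]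
  · rw [moment_eq_zero_of_lt hW hP (not_le.1 h), bcoef, if_neg (by exact_mod_cast h)]

theorem bcoef_of_lt (W : ℝ → Mat N) (P : ℕ → (Mat N)[X]) {n : ℕ} {k : ℤ} (h : k < n) :
    bcoef W P n k = 0 := if_neg (not_le.2 h)

end

section

/-! ### The asymptotic coefficients of the solution of the Riemann–Hilbert problem -/

variable {N : ℕ} {W : ℝ → Mat N} {n : ℕ} {Y : ℂ → BlockMat N} {c : ℕ → BlockMat N}

theorem normalized_apply_inl (n : ℕ) (Y : ℂ → BlockMat N) (z : ℂ) (i : Fin N ⊕ Fin N)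
    (j : Fin N) : normalized n Y z i (Sum.inl j) = (z ^ n)⁻¹ * Y z i (Sum.inl j) := by
  simp [normalized, Matrix.mul_apply, Matrix.one_apply, mul_comm]

theorem normalized_apply_inr (n : ℕ) (Y : ℂ → BlockMat N) (z : ℂ) (i : Fin N ⊕ Fin N)
    (j : Fin N) : normalized n Y z i (Sum.inr j) = z ^ n * Y z i (Sum.inr j) := by
  simp [normalized, Matrix.mul_apply, Matrix.one_apply, mul_comm]

theorem tendsto_apply {ι α : Type*} {F : α → Matrix ι ι ℂ} {l : Filter α} {A : Matrix ι ι ℂ}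
    (h : Tendsto F l (𝓝 A)) (i j : ι) : Tendsto (fun x => F x i j) l (𝓝 (A i j)) :=
  ((continuous_id.matrix_elem i j).tendsto A).comp h

theorem jump_inl {Yp Ym : BlockMat N} {A : Mat N} (h : Yp = Ym * Matrix.fromBlocks 1 A 0 1)
    (i : Fin N ⊕ Fin N) (j : Fin N) : Yp i (Sum.inl j) = Ym i (Sum.inl j) := by
  simp [h, Matrix.mul_apply, Matrix.one_apply]

theorem jump_inr {Yp Ym : BlockMat N} {A : Mat N} (h : Yp = Ym * Matrix.fromBlocks 1 A 0 1)
    (i : Fin N ⊕ Fin N) (j : Fin N) :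
    Yp i (Sum.inr j) - Ym i (Sum.inr j) = ∑ m, Yp i (Sum.inl m) * A m j := by
  simp only [jump_inl h]
  simp [h, Matrix.mul_apply, Matrix.one_apply]

/-- The first block column of the solution consists of polynomials. -/
theorem IsRHSolution.apply_inl_eq (hY : IsRHSolution W n Y) (hc : HasExpansion (normalized n Y) c)
    (i : Fin N ⊕ Fin N) (j : Fin N) {z : ℂ} (hz : z.im ≠ 0) :
    Y z i (Sum.inl j) = ∑ l ∈ Finset.range (n + 1), z ^ (n - l) * c l i (Sum.inl j) := by
  obtain ⟨Yp, Ym, hYp, hYm, htp, htm, hjump⟩ := hY.jump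
  -- The jump matrix leaves the first block column unchanged, so that column is entire; the growth
  -- z^n then makes it polynomial.
  obtain ⟨F, hF, hFY⟩ := exists_entire_extension (f := fun z => Y z i (Sum.inl j))
    (g := fun x => Yp x i (Sum.inl j)) (hY.analytic _ _) (hYp.matrix_elem _ _)
    (fun x => tendsto_apply (htp x) _ _)
    (fun x => by simpa only [jump_inl (hjump x)] using tendsto_apply (htm x) i (Sum.inl j))
  rw [← hFY z hz]
  refine sub_eq_zero.1 (eq_zero_of_isBigO_inv (f := fun z => F z -
    ∑ l ∈ Finset.range (n + 1), z ^ (n - l) * c l i (Sum.inl j)) (by fun_prop) ?_ z)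
  have h := (Asymptotics.isBigO_refl (fun z : ℂ => z ^ n) offReal).mul (hc n i (Sum.inl j))
  refine h.congr' ?_ ?_
  · filter_upwards [eventually_offReal_im_ne_zero, eventually_offReal_ne_zero] with w hw hw0
    rw [hFY w hw, Matrix.sub_apply, normalized_apply_inl, mul_sub,
      mul_inv_cancel_left₀ (pow_ne_zero n hw0), Matrix.sum_apply, Finset.mul_sum]
    congr 1
    refine Finset.sum_congr rfl fun l hl => ?_
    rw [Finset.mem_range] at hl
    rw [Matrix.smul_apply, smul_eq_mul, ← mul_assoc, pow_sub₀ w hw0 (by omega)]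
  · filter_upwards [eventually_offReal_ne_zero] with w hw0
    rw [pow_succ, mul_inv, mul_inv_cancel_left₀ (pow_ne_zero _ hw0)]

/-- z^{-n} times a polynomial of degree at most n is already a finite sum in 1/z. By induction all
coefficients between n and l vanish, so the expansion to order l shows that the constant c_l is
O(1/z). -/
theorem IsRHSolution.coeff_inl_eq_zero (hY : IsRHSolution W n Y)
    (hc : HasExpansion (normalized n Y) c) (i : Fin N ⊕ Fin N) (j : Fin N) (l : ℕ) (hl : n < l) :
    c l i (Sum.inl j) = 0 := by
  induction l using Nat.strong_induction_on with
  | _ l ih =>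
    refine eq_zero_of_isBigO_inv (f := fun _ => c l i (Sum.inl j)) (by fun_prop) ?_ 0
    have h := (Asymptotics.isBigO_refl (fun z : ℂ => -z ^ l) offReal).mul (hc l i (Sum.inl j))
    refine h.congr' ?_ (EventuallyEq.refl _ _) |>.trans ?_
    · filter_upwards [eventually_offReal_im_ne_zero, eventually_offReal_ne_zero] with w hw hw0
      have e1 : ∑ m ∈ Finset.range l, (w ^ m)⁻¹ * c m i (Sum.inl j)
          = ∑ m ∈ Finset.range (n + 1), (w ^ m)⁻¹ * c m i (Sum.inl j) := by
        refine (Finset.sum_subset (Finset.range_mono hl) fun m hm hm' => ?_).symm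
        rw [Finset.mem_range] at hm hm'
        rw [ih m hm (by omega), mul_zero]
      rw [Matrix.sub_apply, normalized_apply_inl, hY.apply_inl_eq hc i j hw, Matrix.sum_apply]
      simp only [Matrix.smul_apply, smul_eq_mul]
      rw [Finset.sum_range_succ (fun x => (w ^ x)⁻¹ * c x i (Sum.inl j)) l, e1, Finset.mul_sum]
      have e2 : ∑ m ∈ Finset.range (n + 1), (w ^ n)⁻¹ * (w ^ (n - m) * c m i (Sum.inl j))
          = ∑ m ∈ Finset.range (n + 1), (w ^ m)⁻¹ * c m i (Sum.inl j) := by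
        refine Finset.sum_congr rfl fun m hm => ?_
        rw [Finset.mem_range] at hm
        rw [pow_sub₀ w hw0 (by omega), mul_assoc, inv_mul_cancel_left₀ (pow_ne_zero _ hw0)]
      rw [e2, sub_add_cancel_left, neg_mul_neg, mul_inv_cancel_left₀ (pow_ne_zero _ hw0)]
    · refine EventuallyEq.isBigO (f₁ := fun z : ℂ => -z ^ l * (z ^ (l + 1))⁻¹)
        (f₂ := fun z : ℂ => -z⁻¹) ?_ |>.trans ?_
      · filter_upwards [eventually_offReal_ne_zero] with w hw0
        rw [pow_succ, mul_inv, neg_mul, mul_inv_cancel_left₀ (pow_ne_zero _ hw0)]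
      · exact (Asymptotics.isBigO_refl _ _).neg_left

/-- The moments of the first block column, in terms of the second one. -/
theorem IsRHSolution.integral_row (hY : IsRHSolution W n Y)
    (hc : HasExpansion (normalized n Y) c) (i : Fin N ⊕ Fin N) (j : Fin N) (k : ℕ)
    (hint : Integrable fun x : ℝ => ∑ m, (x : ℂ) ^ k *
      ((∑ l ∈ Finset.range (n + 1), (x : ℂ) ^ (n - l) * c l i (Sum.inl m)) * W x m j)) :
    ∫ x : ℝ, ∑ m, (x : ℂ) ^ k *
      ((∑ l ∈ Finset.range (n + 1), (x : ℂ) ^ (n - l) * c l i (Sum.inl m)) * W x m j)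
    = -(2 * Real.pi * Complex.I) * if n ≤ k + 1 then c (k + 1 - n) i (Sum.inr j) else 0 := by
  obtain ⟨Yp, Ym, hYp, hYm, htp, htm, hjump⟩ := hY.jump
  have hYpx : ∀ (x : ℝ) m, Yp x i (Sum.inl m)
      = ∑ l ∈ Finset.range (n + 1), (x : ℂ) ^ (n - l) * c l i (Sum.inl m) := by
    intro x m
    have hne : (𝓝[{z : ℂ | 0 < z.im}] (x : ℂ)).NeBot := by
      rw [← mem_closure_iff_nhdsWithin_neBot, Complex.closure_setOfPred_lt_im]
      simp
    refine tendsto_nhds_unique (tendsto_apply (htp x) i (Sum.inl m)) ?_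
    have hcont : Continuous fun z : ℂ =>
      ∑ l ∈ Finset.range (n + 1), z ^ (n - l) * c l i (Sum.inl m) := by fun_prop
    refine ((hcont.tendsto (x : ℂ)).mono_left nhdsWithin_le_nhds).congr'
      (eventually_nhdsWithin_of_forall fun z hz => ?_)
    exact (hY.apply_inl_eq hc i m (ne_of_gt hz)).symm
  -- The integrand is the jump of z^k times an entry of the second block column, so its integral is
  -- determined by the coefficient of 1/z at infinity.
  have hj : ∀ x : ℝ, ∑ m, (x : ℂ) ^ k *
      ((∑ l ∈ Finset.range (n + 1), (x : ℂ) ^ (n - l) * c l i (Sum.inl m)) * W x m j)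
      = (x : ℂ) ^ k * Yp x i (Sum.inr j) - (x : ℂ) ^ k * Ym x i (Sum.inr j) := by
    intro x
    rw [← mul_sub, jump_inr (hjump x), Finset.mul_sum]
    simp only [hYpx]
  simp_rw [hj] at hint ⊢
  -- At infinity the entry is z^{k-n} ∑ c_l z^{-l}. The terms with l + n ≤ k form the polynomial q,
  -- the term l + n = k + 1 is the residue, and the rest is O(z⁻²). Expanding to order k + 1
  -- suffices for every n ≥ 0.
  set q : ℂ → ℂ := fun z => ∑ l ∈ Finset.range (k + 2),
    if l + n ≤ k then z ^ (k - (l + n)) * c l i (Sum.inr j) else 0 with hq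
  have hqd : Differentiable ℂ q := by
    refine Differentiable.fun_sum fun l _ => ?_
    split_ifs <;> fun_prop
  refine integral_jump (f := fun z => z ^ k * Y z i (Sum.inr j)) hqd
    (DifferentiableOn.mul (by fun_prop) (hY.analytic _ _))
    ((Complex.continuous_ofReal.pow k).mul (hYp.matrix_elem _ _))
    ((Complex.continuous_ofReal.pow k).mul (hYm.matrix_elem _ _))
    (fun x => Tendsto.mul ((continuous_pow k).continuousAt.mono_left nhdsWithin_le_nhds)
      (tendsto_apply (htp x) _ _))
    (fun x => Tendsto.mul ((continuous_pow k).continuousAt.mono_left nhdsWithin_le_nhds)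
      (tendsto_apply (htm x) _ _)) ?_ hint
  have h1 : (fun z : ℂ => z ^ k * (z ^ n)⁻¹ * (normalized n Y z -
      ∑ l ∈ Finset.range (k + 1 + 1), (z ^ l)⁻¹ • c l) i (Sum.inr j))
      =O[offReal] fun z : ℂ => (z ^ 2)⁻¹ := by
    refine ((Asymptotics.isBigO_refl (fun z : ℂ => z ^ k * (z ^ n)⁻¹) offReal).mul
      (hc (k + 1) i (Sum.inr j))).trans ?_
    refine EventuallyEq.isBigO (f₂ := fun z : ℂ => (z ^ (n + 2))⁻¹) ?_ |>.trans
      (isBigO_inv_pow_of_le (by omega))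
    filter_upwards [eventually_offReal_ne_zero] with w hw0
    field_simp
    ring
  have h2 : (fun z : ℂ => ∑ l ∈ Finset.range (k + 2),
      if k + 2 ≤ l + n then z ^ k * (z ^ (l + n))⁻¹ * c l i (Sum.inr j) else 0)
      =O[offReal] fun z : ℂ => (z ^ 2)⁻¹ := by
    refine Asymptotics.IsBigO.fun_sum fun l _ => ?_
    split_ifs with hl
    · have := ((Asymptotics.isBigO_refl (fun z : ℂ => z ^ k) offReal).mul
        (isBigO_inv_pow_of_le hl)).mul
        (Asymptotics.isBigO_refl (fun _ : ℂ => c l i (Sum.inr j)) offReal)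
      refine this.trans ?_
      refine EventuallyEq.isBigO (f₂ := fun z : ℂ => c l i (Sum.inr j) * (z ^ 2)⁻¹) ?_ |>.trans
        ((Asymptotics.isBigO_refl _ _).const_mul_left _)
      filter_upwards [eventually_offReal_ne_zero] with w hw0
      rw [pow_add, mul_inv, mul_inv_cancel_left₀ (pow_ne_zero _ hw0), mul_comm]
    · exact Asymptotics.isBigO_zero _ _
  have ha : (if n ≤ k + 1 then c (k + 1 - n) i (Sum.inr j) else 0)
      = ∑ l ∈ Finset.range (k + 2), if l + n = k + 1 then c l i (Sum.inr j) else 0 := by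
    split_ifs with hn
    · rw [Finset.sum_eq_single (k + 1 - n), if_pos (by omega)]
      · intro l _ hl
        rw [if_neg (by omega)]
      · intro hl
        simp at hl
        omega
    · exact (Finset.sum_eq_zero fun l _ => if_neg (by omega)).symm
  refine (h1.add h2).congr' ?_ (EventuallyEq.refl _ _)
  filter_upwards [eventually_offReal_ne_zero] with w hw0
  rw [Matrix.sub_apply, normalized_apply_inr, Matrix.sum_apply, ha, hq, mul_sub,
    mul_assoc, inv_mul_cancel_left₀ (pow_ne_zero _ hw0), sub_add, sub_right_inj,
    Finset.sum_mul, ← Finset.sum_add_distrib, Finset.mul_sum, ← Finset.sum_sub_distrib]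
  refine Finset.sum_congr rfl fun l _ => ?_
  rw [Matrix.smul_apply, smul_eq_mul]
  rcases lt_trichotomy (l + n) (k + 1) with h | h | h
  · rw [if_neg (by omega), if_pos (by omega), if_neg (by omega), pow_sub₀ w hw0 (by omega),
      pow_add, mul_inv]
    ring
  · rw [if_neg (by omega), if_neg (by omega), if_pos h]
    have e : w ^ l * w ^ n = w ^ k * w := by rw [← pow_add, h, pow_succ]
    have : w ^ k * (w ^ n)⁻¹ * (w ^ l)⁻¹ = w⁻¹ := by
      rw [mul_assoc, ← mul_inv, mul_comm (w ^ n), e, mul_inv,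
        mul_inv_cancel_left₀ (pow_ne_zero _ hw0)]
    linear_combination c l i (Sum.inr j) * this
  · rw [if_pos (by omega), if_neg (by omega), if_neg (by omega), pow_add, mul_inv]
    ring

end

/-! ### Identification of the asymptotic coefficients with orthogonal polynomials and moments -/

section

variable {N : ℕ}

/-- The polynomial in the first block column of a solution of the Riemann–Hilbert problem with
asymptotic coefficients `c`; the block row is selected by `r`. -/
noncomputable def rowPoly (c : ℕ → BlockMat N) (n : ℕ) (r : Fin N → Fin N ⊕ Fin N) : (Mat N)[X] :=
  ∑ l ∈ Finset.range (n + 1), monomial (n - l) ((c l).submatrix r Sum.inl)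

theorem coeff_rowPoly (c : ℕ → BlockMat N) {n l : ℕ} (r : Fin N → Fin N ⊕ Fin N) (hl : l ≤ n) :
    (rowPoly c n r).coeff (n - l) = (c l).submatrix r Sum.inl := by
  rw [rowPoly, finsetSum_coeff, Finset.sum_eq_single l]
  · simp
  · intro b hb hbl
    rw [Finset.mem_range] at hb
    rw [coeff_monomial, if_neg (by omega)]
  · simp; omega

theorem natDegree_rowPoly_le (c : ℕ → BlockMat N) (n : ℕ) (r : Fin N → Fin N ⊕ Fin N) :
    (rowPoly c n r).natDegree ≤ n :=
  natDegree_sum_le_of_forall_le _ _ fun l _ => (natDegree_monomial_le _).trans (Nat.sub_le n l)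

theorem pval_sum {σ : Type*} (s : Finset σ) (Q : σ → (Mat N)[X]) (z : ℂ) :
    pval (∑ k ∈ s, Q k) z = ∑ k ∈ s, pval (Q k) z := by
  classical
  induction s using Finset.induction_on with
  | empty => simp [pval]
  | insert a s ha ih => rw [Finset.sum_insert ha, Finset.sum_insert ha, pval_add, Pi.add_apply, ih]

theorem pval_rowPoly_apply (c : ℕ → BlockMat N) (n : ℕ) (r : Fin N → Fin N ⊕ Fin N) (z : ℂ)
    (i m : Fin N) : pval (rowPoly c n r) z i m
      = ∑ l ∈ Finset.range (n + 1), z ^ (n - l) * c l (r i) (Sum.inl m) := by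
  rw [rowPoly, pval_sum, Matrix.sum_apply]
  simp [pval_monomial]

theorem degree_lt_of_coeff_eq_zero {Q : (Mat N)[X]} {n : ℕ} (hd : Q.natDegree ≤ n)
    (h0 : Q.coeff n = 0) : Q.degree < n := by
  rw [degree_lt_iff_coeff_zero]
  intro m hm
  rcases hm.eq_or_lt with rfl | hm
  · exact h0
  · exact coeff_eq_zero_of_natDegree_lt (by omega)

theorem sub_C_mul {R : Type*} [Ring R] (p q : R[X]) (a : R) : p - C a * q = p + C (-a) * q := by
  rw [map_neg, neg_mul, sub_eq_add_neg]

variable {W : ℝ → Mat N} {P : ℕ → (Mat N)[X]} {κ : ℕ → Mat N} {n : ℕ} {Y : ℂ → BlockMat N}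
  {c : ℕ → BlockMat N}

theorem moment_rowPoly (hW : IsWeight W) (hY : IsRHSolution W n Y)
    (hc : HasExpansion (normalized n Y) c) (r : Fin N → Fin N ⊕ Fin N) (k : ℕ) :
    moment W (pval (rowPoly c n r)) k = -(2 * Real.pi * Complex.I) •
      if n ≤ k + 1 then (c (k + 1 - n)).submatrix r Sum.inr else 0 := by
  ext i j
  have e : ∀ x : ℝ, (((x : ℂ) ^ k) • (pval (rowPoly c n r) x * W x)) i j
      = ∑ m, (x : ℂ) ^ k *
      ((∑ l ∈ Finset.range (n + 1), (x : ℂ) ^ (n - l) * c l (r i) (Sum.inl m)) * W x m j) := by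
    intro x
    simp only [Matrix.smul_apply, Matrix.mul_apply, smul_eq_mul, Finset.mul_sum, pval_rowPoly_apply]
  have hint := hW.integrable_moment (rowPoly c n r) k i j
  simp_rw [e] at hint
  simp only [moment, matIntegral, Matrix.of_apply]
  simp_rw [e]
  rw [hY.integral_row hc (r i) j k hint, Matrix.smul_apply, smul_eq_mul]
  split_ifs <;> simp

theorem two_pi_I_ne_zero : (2 * (Real.pi : ℂ) * Complex.I) ≠ 0 := Complex.two_pi_I_ne_zero

theorem submatrix_inr_eq (hW : IsWeight W) (hY : IsRHSolution W n Y)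
    (hc : HasExpansion (normalized n Y) c) (r : Fin N → Fin N ⊕ Fin N) {l k : ℕ}
    (hk : n + l = k + 1) :
    (c l).submatrix r Sum.inr
      = -((2 * (Real.pi : ℂ) * Complex.I)⁻¹ • moment W (pval (rowPoly c n r)) k) := by
  rw [moment_rowPoly hW hY hc, if_pos (by omega), show k + 1 - n = l by omega, smul_smul, mul_neg,
    inv_mul_cancel₀ two_pi_I_ne_zero, neg_smul, neg_neg, one_smul]

section

variable (hW : IsWeight W) (hP : IsMonicOrthogonal W P) (hκ : IsNormalizing W P κ)
  (hY : IsRHSolution W n Y) (hc₀ : c 0 = 1) (hc : HasExpansion (normalized n Y) c)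
include hW hP hκ hY hc₀ hc

/-- Both sides are monic of degree n. The moments of order below n - 1 vanish because they precede
the expansion; the one of order n - 1 is a multiple of the off-diagonal block of c 0 = 1. Hence the
difference has degree below n and no moments of order below n. -/
theorem rowPoly_inl : rowPoly c n Sum.inl = P n := by
  rw [← sub_eq_zero]
  refine eq_zero_of_moment_eq_zero hW hP hκ (n := n) ?_ fun k hk => ?_
  · refine degree_lt_of_coeff_eq_zero ?_ ?_
    · exact (natDegree_sub_le _ _).trans (max_le (natDegree_rowPoly_le _ _ _) (hP n).1)
    · have := coeff_rowPoly c Sum.inl (Nat.zero_le n)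
      rw [Nat.sub_zero] at this
      rw [coeff_sub, this, (hP n).2.1, hc₀, sub_eq_zero]
      ext i j
      simp [Matrix.one_apply]
  · have e : rowPoly c n Sum.inl - P n = rowPoly c n Sum.inl + C (-1) * P n := by
      rw [← sub_C_mul, map_one, one_mul]
    rw [e, pval_add, hW.moment_add, pval_C_mul, hW.moment_const_mul,
      moment_eq_zero_of_lt hW hP hk, Matrix.mul_zero, add_zero, moment_rowPoly hW hY hc]
    split_ifs with h
    · have h0 : k + 1 - n = 0 := by omega
      rw [h0, hc₀]
      ext i j
      simp
    · simp

theorem toBlocks₁₁_eq (l : ℕ) :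
    (c l).toBlocks₁₁ = if l ≤ n then (P n).coeff (n - l) else 0 := by
  split_ifs with h
  · rw [← rowPoly_inl hW hP hκ hY hc₀ hc, coeff_rowPoly c _ h]
    rfl
  · ext i j
    exact hY.coeff_inl_eq_zero hc _ _ l (not_le.1 h)

theorem toBlocks₁₂_eq (l : ℕ) :
    (c l).toBlocks₁₂ = -((2 * (Real.pi : ℂ) * Complex.I)⁻¹ • bcoef W P n ((n : ℤ) + l - 1)) := by
  -- The index n + l - 1 is a natural number except when n = l = 0. There it is -1, and both sides
  -- vanish.
  rcases Nat.eq_zero_or_pos (n + l) with h | h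
  · obtain ⟨rfl, rfl⟩ : n = 0 ∧ l = 0 := by omega
    rw [bcoef_of_lt W P (by simp), smul_zero, neg_zero, hc₀]
    ext i j
    simp [Matrix.toBlocks₁₂]
  · obtain ⟨k, hk⟩ : ∃ k, n + l = k + 1 := ⟨n + l - 1, by omega⟩
    have := submatrix_inr_eq hW hY hc Sum.inl hk
    rw [rowPoly_inl hW hP hκ hY hc₀ hc, ← bcoef_natCast hW hP] at this
    rw [show (n : ℤ) + l - 1 = k by omega, ← this]
    rfl

end

section

variable {Y : ℂ → BlockMat N}

theorem toBlocks₂₁_zero (hY : IsRHSolution W 0 Y) (hc₀ : c 0 = 1)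
    (hc : HasExpansion (normalized 0 Y) c) (l : ℕ) : (c l).toBlocks₂₁ = 0 := by
  ext i j
  rcases Nat.eq_zero_or_pos l with rfl | hl
  · simp [hc₀, Matrix.toBlocks₂₁]
  · exact hY.coeff_inl_eq_zero hc _ _ l hl

/-- For n = 0 the polynomial in the lower left block is zero, so the moments that would give the
later coefficients vanish. -/
theorem toBlocks₂₂_zero (hW : IsWeight W) (hY : IsRHSolution W 0 Y) (hc₀ : c 0 = 1)
    (hc : HasExpansion (normalized 0 Y) c) (l : ℕ) :
    (c l).toBlocks₂₂ = if l = 0 then 1 else 0 := by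
  rcases Nat.eq_zero_or_pos l with rfl | hl
  · ext i j
    simp [hc₀, Matrix.toBlocks₂₂, Matrix.one_apply]
  · have h0 : rowPoly c 0 Sum.inr = 0 := by
      have h := toBlocks₂₁_zero hY hc₀ hc 0
      have h' : (c 0).submatrix Sum.inr Sum.inl = (0 : Mat N) := h
      simp [rowPoly, h']
    obtain ⟨k, hk⟩ : ∃ k, 0 + l = k + 1 := ⟨l - 1, by omega⟩
    have := submatrix_inr_eq hW hY hc Sum.inr hk
    rw [h0] at this
    rw [if_neg hl.ne']
    refine this.trans ?_
    ext i j
    simp [moment, matIntegral, pval]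

end

section

variable (hW : IsWeight W) (hP : IsMonicOrthogonal W P) (hκ : IsNormalizing W P κ)
  (hY : IsRHSolution W (n + 1) Y) (hc₀ : c 0 = 1) (hc : HasExpansion (normalized (n + 1) Y) c)
include hW hP hκ hY hc₀ hc

/-- The lower left block of c 0 = 1 vanishes, which lowers the degree to n. The moments of order
below n are zero and the n-th is -2πi, from the lower right block of c 0. Since γ_n inverts the n-th
moment of P_n, this fixes the factor -2πi γ_n. -/
theorem rowPoly_inr :
    rowPoly c (n + 1) Sum.inr = C (-((2 * (Real.pi : ℂ) * Complex.I) • gam κ n)) * P n := by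
  rw [← sub_eq_zero]
  refine eq_zero_of_moment_eq_zero hW hP hκ (n := n + 1) ?_ fun k hk => ?_
  · refine degree_lt_of_coeff_eq_zero ?_ ?_
    · refine (natDegree_sub_le _ _).trans (max_le (natDegree_rowPoly_le _ _ _) ?_)
      exact (natDegree_C_mul_le _ _).trans ((hP n).1.trans (Nat.le_succ n))
    · have := coeff_rowPoly c Sum.inr (Nat.zero_le (n + 1))
      rw [Nat.sub_zero] at this
      rw [coeff_sub, this, coeff_C_mul,
        coeff_eq_zero_of_natDegree_lt (lt_of_le_of_lt (hP n).1 (Nat.lt_succ_self n)), mul_zero,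
        sub_zero, hc₀]
      ext i j
      simp
  · rw [sub_C_mul, pval_add, hW.moment_add, pval_C_mul,
      hW.moment_const_mul, moment_rowPoly hW hY hc, neg_neg, Matrix.smul_mul]
    rcases (Nat.lt_succ_iff.1 hk).eq_or_lt with rfl | hk'
    · rw [gam_mul_moment hW hP hκ, if_pos le_rfl, Nat.sub_self, hc₀, neg_smul, neg_add_eq_zero]
      congr 1
      ext i j
      simp [Matrix.one_apply]
    · rw [if_neg (by omega), smul_zero, moment_eq_zero_of_lt hW hP hk', Matrix.mul_zero, smul_zero,
        add_zero]

theorem toBlocks₂₁_succ (l : ℕ) :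
    (c (l + 1)).toBlocks₂₁ = -((2 * (Real.pi : ℂ) * Complex.I) •
      (gam κ n * if l ≤ n then (P n).coeff (n - l) else 0)) := by
  split_ifs with h
  · have := coeff_rowPoly c Sum.inr (Nat.succ_le_succ h)
    rw [rowPoly_inr hW hP hκ hY hc₀ hc, coeff_C_mul, Nat.succ_sub_succ, neg_mul,
      Matrix.smul_mul] at this
    exact this.symm
  · rw [Matrix.mul_zero, smul_zero, neg_zero]
    ext i j
    exact hY.coeff_inl_eq_zero hc _ _ _ (by omega)

theorem toBlocks₂₂_succ (l : ℕ) :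
    (c l).toBlocks₂₂ = gam κ n * bcoef W P n ((n : ℤ) + l) := by
  have := submatrix_inr_eq hW hY hc Sum.inr (l := l) (k := n + l) (by omega)
  rw [rowPoly_inr hW hP hκ hY hc₀ hc, pval_C_mul, hW.moment_const_mul, ← bcoef_natCast hW hP,
    Matrix.neg_mul, smul_neg, neg_neg, Matrix.smul_mul, smul_smul,
    inv_mul_cancel₀ two_pi_I_ne_zero, one_smul] at this
  rw [← Nat.cast_add]
  exact this

end

end

section

/-! ### The coefficient matrix -/

variable {N : ℕ}

/-- The polynomial part of `(∑ a_l z^{-l}) (∑ M_p z^p) (∑ b_k z^{-k})`, for `p ≤ m`. -/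
noncomputable def convSum (M : ℕ → Mat N) (m : ℕ) (a b : ℕ → Mat N) (z : ℂ) : Mat N :=
  ∑ p ∈ Finset.range (m + 1), ∑ l ∈ Finset.range (p + 1), ∑ k ∈ Finset.range (p + 1),
    if l + k ≤ p then z ^ (p - l - k) • (a l * M p * b k) else 0

theorem convSum_congr {M : ℕ → Mat N} {m : ℕ} {a a' b b' : ℕ → Mat N} {z : ℂ}
    (ha : ∀ l, a l = a' l) (hb : ∀ k, b k = b' k) : convSum M m a b z = convSum M m a' b' z := by
  rw [funext ha, funext hb]

theorem convSum_mul_mul (M : ℕ → Mat N) (m : ℕ) (a b : ℕ → Mat N) (z : ℂ) (s t : ℂ) (A B : Mat N) :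
    convSum M m (fun l => s • (A * a l)) (fun k => t • (b k * B)) z
      = (s * t) • (A * convSum M m a b z * B) := by
  simp only [convSum, Finset.smul_sum, Matrix.mul_sum, Matrix.sum_mul]
  refine Finset.sum_congr rfl fun p _ => Finset.sum_congr rfl fun l _ =>
    Finset.sum_congr rfl fun k _ => ?_
  split_ifs
  · simp only [Matrix.smul_mul, Matrix.mul_smul, Matrix.mul_assoc, smul_smul]
    congr 1
    ring
  · simp

theorem conjTranspose_convSum (M : ℕ → Mat N) (m : ℕ) (a b : ℕ → Mat N) (z : ℂ) :
    (convSum M m a b (starRingEnd ℂ z))ᴴ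
      = convSum (fun p => (M p)ᴴ) m (fun k => (b k)ᴴ) (fun l => (a l)ᴴ) z := by
  simp only [convSum, Matrix.conjTranspose_sum]
  refine Finset.sum_congr rfl fun p _ => ?_
  rw [Finset.sum_comm]
  refine Finset.sum_congr rfl fun l _ => Finset.sum_congr rfl fun k _ => ?_
  rw [add_comm k l]
  split_ifs with h
  · rw [Matrix.conjTranspose_smul, Matrix.conjTranspose_mul, Matrix.conjTranspose_mul,
      Matrix.mul_assoc, show p - k - l = p - l - k by omega]
    simp
  · simp

/-- A factor 1/z is moved from the left series to the right one. It is needed for the lower left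
coefficients, which start at index 1 and become the coefficients of P_n only after a shift. -/
theorem convSum_shift (M : ℕ → Mat N) (m : ℕ) {a b b' : ℕ → Mat N} (ha : a 0 = 0) (hb₀ : b' 0 = 0)
    (hb : ∀ k, b' (k + 1) = b k) (z : ℂ) :
    convSum M m a b z = convSum M m (fun l => a (l + 1)) b' z := by
  refine Finset.sum_congr rfl fun p _ => ?_
  rw [Finset.sum_range_succ']
  have h0 : ∑ k ∈ Finset.range (p + 1),
      (if 0 + k ≤ p then z ^ (p - 0 - k) • (a 0 * M p * b k) else 0) = 0 :=
    Finset.sum_eq_zero fun k _ => by simp [ha]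
  rw [h0, add_zero]
  have h1 : ∀ l ∈ Finset.range p, ∑ k ∈ Finset.range (p + 1),
      (if l + 1 + k ≤ p then z ^ (p - (l + 1) - k) • (a (l + 1) * M p * b k) else 0)
      = ∑ k ∈ Finset.range (p + 1),
      (if l + k ≤ p then z ^ (p - l - k) • (a (l + 1) * M p * b' k) else 0) := by
    intro l _
    rw [Finset.sum_range_succ, Finset.sum_range_succ' _ p, if_neg (by omega), hb₀]
    simp only [Matrix.mul_zero, smul_zero, ite_self, add_zero]
    refine Finset.sum_congr rfl fun k _ => ?_
    rw [hb, show p - (l + 1) - k = p - l - (k + 1) by omega]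
    exact if_congr (by omega) rfl rfl
  rw [Finset.sum_congr rfl h1, Finset.sum_range_succ _ p]
  have h2 : ∑ k ∈ Finset.range (p + 1),
      (if p + k ≤ p then z ^ (p - p - k) • (a (p + 1) * M p * b' k) else 0) = 0 := by
    refine Finset.sum_eq_zero fun k _ => ?_
    split_ifs with h
    · obtain rfl : k = 0 := by omega
      simp [hb₀]
    · rfl
  rw [h2, add_zero]

theorem convSum_shift' (M : ℕ → Mat N) (m : ℕ) {a a' b : ℕ → Mat N} (hb : b 0 = 0) (ha₀ : a' 0 = 0)
    (ha : ∀ k, a' (k + 1) = a k) (z : ℂ) :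
    convSum M m a b z = convSum M m a' (fun l => b (l + 1)) z := by
  have h := convSum_shift (fun p => (M p)ᴴ) m (a := fun k => (b k)ᴴ) (b := fun k => (a k)ᴴ)
    (b' := fun k => (a' k)ᴴ) (by simp [hb]) (by simp [ha₀]) (fun k => by simp [ha])
    (starRingEnd ℂ z)
  have h' := congrArg Matrix.conjTranspose h
  rw [conjTranspose_convSum, conjTranspose_convSum] at h'
  simpa using h'

/-- Collect the terms by the index k = m - j of the right factor and put p = k + q. The sum over l ≤
q is then a truncated polynomial, and the sum over q has the form of Δ_j. -/
theorem convSum_eq_sum (M : ℕ → Mat N) (m : ℕ) (a b : ℕ → Mat N) (z : ℂ) :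
    convSum M m a b z = ∑ j ∈ Finset.range (m + 1), (∑ k ∈ Finset.range (j + 1),
      (∑ l ∈ Finset.range (k + 1), z ^ (k - l) • a l) * M (m - j + k)) * b (m - j) := by
  rw [← Finset.sum_range_reflect]
  have e1 : convSum M m a b z = ∑ k ∈ Finset.range (m + 1), ∑ p ∈ Finset.range (m + 1),
      ∑ l ∈ Finset.range (p + 1), if l + k ≤ p then z ^ (p - l - k) • (a l * M p * b k) else 0 := by
    rw [Finset.sum_comm]
    refine Finset.sum_congr rfl fun p hp => ?_
    rw [Finset.sum_comm]
    refine Finset.sum_subset (Finset.range_mono (by simp at hp; omega)) fun k _ hk => ?_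
    refine Finset.sum_eq_zero fun l _ => if_neg ?_
    rw [Finset.mem_range] at hk
    omega
  rw [e1]
  refine Finset.sum_congr rfl fun k hk => ?_
  rw [Finset.mem_range] at hk
  rw [show m + 1 - 1 - k = m - k by omega, show m - (m - k) = k by omega, Finset.sum_mul]
  have e2 : ∑ p ∈ Finset.range (m + 1), ∑ l ∈ Finset.range (p + 1),
      (if l + k ≤ p then z ^ (p - l - k) • (a l * M p * b k) else 0)
      = ∑ p ∈ Finset.Ico k (m + 1), ∑ l ∈ Finset.range (p + 1),
      (if l + k ≤ p then z ^ (p - l - k) • (a l * M p * b k) else 0) := by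
    refine (Finset.sum_subset (fun p hp => ?_) fun p _ hp => ?_).symm
    · simp at hp ⊢; omega
    · refine Finset.sum_eq_zero fun l _ => if_neg fun h => hp ?_
      simp at *; omega
  rw [e2, Finset.sum_Ico_eq_sum_range, show m + 1 - k = m - k + 1 by omega]
  refine Finset.sum_congr rfl fun q _ => ?_
  rw [Finset.sum_mul, Finset.sum_mul]
  refine (Finset.sum_subset (Finset.range_mono (by omega)) fun l _ hl => if_neg ?_).symm.trans
    (Finset.sum_congr rfl fun l hl => ?_)
  · rw [Finset.mem_range] at hl
    omega
  · rw [Finset.mem_range] at hl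
    rw [if_pos (by omega), show k + q - l - k = q - l by omega, Matrix.smul_mul, Matrix.smul_mul]

/-- The coefficients of `P_n`, in descending order. -/
noncomputable def descCoeff (P : ℕ → (Mat N)[X]) (n l : ℕ) : Mat N :=
  if l ≤ n then (P n).coeff (n - l) else 0

theorem trunc_eq_sum (P : ℕ → (Mat N)[X]) (n k : ℕ) (z : ℂ) :
    trunc P n k z = ∑ l ∈ Finset.range (k + 1), z ^ (k - l) • descCoeff P n l := by
  simp only [trunc, descCoeff, smul_ite, smul_zero]

theorem convSum_descCoeff (P : ℕ → (Mat N)[X]) (G : (Mat N)[X]) (n : ℕ) (b : ℕ → Mat N) (z : ℂ) :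
    convSum G.coeff G.natDegree (descCoeff P n) b z
      = ∑ j ∈ Finset.range (G.natDegree + 1), Del P G j n z * b (G.natDegree - j) := by
  simp only [convSum_eq_sum, Del, trunc_eq_sum]

theorem convSum_descCoeff' (P : ℕ → (Mat N)[X]) (G : (Mat N)[X]) (n : ℕ) (b : ℕ → Mat N) (z : ℂ) :
    convSum (fun p => (G.coeff p)ᴴ) G.natDegree b (fun l => (descCoeff P n l)ᴴ) z
      = ∑ j ∈ Finset.range (G.natDegree + 1), b (G.natDegree - j) * adj (Del P G j n) z := by
  have h := congrArg Matrix.conjTranspose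
    (convSum_descCoeff P G n (fun k => (b k)ᴴ) (starRingEnd ℂ z))
  rw [conjTranspose_convSum] at h
  simpa [Matrix.conjTranspose_sum, Matrix.conjTranspose_mul, adj] using h

theorem sum_fromBlocks {σ : Type*} (s : Finset σ) (A B C D : σ → Mat N) :
    ∑ k ∈ s, Matrix.fromBlocks (A k) (B k) (C k) (D k)
      = Matrix.fromBlocks (∑ k ∈ s, A k) (∑ k ∈ s, B k) (∑ k ∈ s, C k) (∑ k ∈ s, D k) := by
  ext i j
  rcases i with i | i <;> rcases j with j | j <;> simp [Matrix.sum_apply]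

/-- Conjugation by J exchanges the diagonal blocks and the off-diagonal blocks of c_k^*, so its rows
become (δ^*, β^*) and (η^*, α^*). -/
theorem polyPart_eq_fromBlocks (c : ℕ → BlockMat N) (G : (Mat N)[X]) {α β η δ : ℕ → Mat N}
    (hα : ∀ l, (c l).toBlocks₁₁ = α l) (hβ : ∀ l, (c l).toBlocks₁₂ = β l)
    (hη : ∀ l, (c l).toBlocks₂₁ = η l) (hδ : ∀ l, (c l).toBlocks₂₂ = δ l) (z : ℂ) :
    polyPart c G z = Matrix.fromBlocks
      (convSum G.coeff G.natDegree α (fun k => (δ k)ᴴ) z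
        - convSum (fun p => (G.coeff p)ᴴ) G.natDegree β (fun k => (η k)ᴴ) z)
      (convSum G.coeff G.natDegree α (fun k => (β k)ᴴ) z
        - convSum (fun p => (G.coeff p)ᴴ) G.natDegree β (fun k => (α k)ᴴ) z)
      (convSum G.coeff G.natDegree η (fun k => (δ k)ᴴ) z
        - convSum (fun p => (G.coeff p)ᴴ) G.natDegree δ (fun k => (η k)ᴴ) z)
      (convSum G.coeff G.natDegree η (fun k => (β k)ᴴ) z
        - convSum (fun p => (G.coeff p)ᴴ) G.natDegree δ (fun k => (α k)ᴴ) z) := by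
  have hc : ∀ l, c l = Matrix.fromBlocks (α l) (β l) (η l) (δ l) := fun l => by
    rw [← hα, ← hβ, ← hη, ← hδ, Matrix.fromBlocks_toBlocks]
  simp only [polyPart, convSum, ← Finset.sum_sub_distrib, ← sum_fromBlocks]
  refine Finset.sum_congr rfl fun p _ => Finset.sum_congr rfl fun l _ =>
    Finset.sum_congr rfl fun k _ => ?_
  split_ifs
  · simp [hc, Matrix.fromBlocks_multiply, Matrix.fromBlocks_conjTranspose, Matrix.fromBlocks_smul, sub_eq_add_neg]
  · simp

theorem star_two_pi_I :
    star (2 * (Real.pi : ℂ) * Complex.I) = -(2 * (Real.pi : ℂ) * Complex.I) := by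
  simp

section

variable {W : ℝ → Mat N} {P : ℕ → (Mat N)[X]} {κ : ℕ → Mat N} {n : ℕ} {Y : ℂ → BlockMat N}
  {c : ℕ → BlockMat N}

theorem conjTranspose_gam (κ : ℕ → Mat N) (n : ℕ) : (gam κ n)ᴴ = gam κ n := by
  simp [gam, Matrix.conjTranspose_mul]

/-- The scalar 2πi is purely imaginary, so taking adjoints of β changes a sign and the difference of
the two convolutions becomes the sum in 𝓐_n. The term j = m drops out, since it contains b_{n,n-1} =
0. -/
theorem toBlocks₁₂_polyPart (hW : IsWeight W) (hP : IsMonicOrthogonal W P)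
    (hκ : IsNormalizing W P κ) (G : (Mat N)[X]) {β : ℕ → Mat N}
    (hβ : ∀ l : ℕ, β l = -((2 * (Real.pi : ℂ) * Complex.I)⁻¹ • bcoef W P n ((n : ℤ) + l - 1)))
    (z : ℂ) :
    convSum G.coeff G.natDegree (descCoeff P n) (fun k => (β k)ᴴ) z
      - convSum (fun p => (G.coeff p)ᴴ) G.natDegree β (fun k => (descCoeff P n k)ᴴ) z
    = -((2 * (Real.pi : ℂ) * Complex.I)⁻¹ • ((gam κ n)⁻¹ * Acal W P κ G n z)) := by
  have hβ' : ∀ l : ℕ, (β l)ᴴ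
      = (2 * (Real.pi : ℂ) * Complex.I)⁻¹ • (bcoef W P n ((n : ℤ) + l - 1))ᴴ := fun l => by
    rw [hβ, Matrix.conjTranspose_neg, Matrix.conjTranspose_smul, star_inv₀, star_two_pi_I, inv_neg,
      neg_smul, neg_neg]
  rw [convSum_descCoeff, convSum_descCoeff', Acal, Matrix.mul_neg, ← Matrix.mul_assoc,
    inv_mul_of_isUnit (isUnit_gam hW hP hκ n), Matrix.one_mul, smul_neg, neg_neg,
    ← Finset.sum_sub_distrib, Finset.sum_range_succ, Finset.smul_sum, Nat.sub_self]
  have h0 : bcoef W P n ((n : ℤ) + (0 : ℕ) - 1) = 0 := bcoef_of_lt W P (by simp)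
  rw [hβ', hβ, h0]
  simp only [Matrix.conjTranspose_zero, smul_zero, Matrix.mul_zero, neg_zero, Matrix.zero_mul,
    sub_zero, add_zero]
  refine Finset.sum_congr rfl fun j hj => ?_
  rw [Finset.mem_range] at hj
  rw [hβ', hβ, Nat.cast_sub hj.le, ← add_sub_assoc, Matrix.mul_smul, Matrix.neg_mul,
    Matrix.smul_mul, sub_neg_eq_add, ← smul_add, add_comm]

theorem polyPart_eq_Fmat_zero (hW : IsWeight W) (hP : IsMonicOrthogonal W P)
    (hκ : IsNormalizing W P κ) (hY : IsRHSolution W 0 Y) (hc₀ : c 0 = 1)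
    (hc : HasExpansion (normalized 0 Y) c) (G : (Mat N)[X]) (z : ℂ) :
    polyPart c G z = Fmat W P κ G 0 z := by
  -- Since P_0 = 1, each truncation P_{0,k} is z^k, and Δ_m is G itself.
  have hD : ∀ z, Del P G G.natDegree 0 z = pval G z := by
    intro z
    rw [Del, pval]
    refine Finset.sum_congr rfl fun k _ => ?_
    rw [trunc_eq_sum, Finset.sum_eq_single 0]
    · simp [descCoeff, (hP 0).2.1]
    · intro l _ hl
      rw [descCoeff, if_neg (by omega), smul_zero]
    · simp
  have hD' : ∀ z, adj (Del P G G.natDegree 0) z = adj (pval G) z := fun z => by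
    simp only [adj, hD]
  have hz : ∀ (M : ℕ → Mat N) (m : ℕ) (b : ℕ → Mat N), convSum M m (fun _ => 0) b z = 0 :=
    fun M m b => by simp [convSum]
  have hz' : ∀ (M : ℕ → Mat N) (m : ℕ) (b : ℕ → Mat N), convSum M m b (fun _ => 0) z = 0 :=
    fun M m b => by simp [convSum]
  rw [polyPart_eq_fromBlocks c G (toBlocks₁₁_eq hW hP hκ hY hc₀ hc)
    (toBlocks₁₂_eq hW hP hκ hY hc₀ hc) (toBlocks₂₁_zero hY hc₀ hc)
    (toBlocks₂₂_zero hW hY hc₀ hc) z, Fmat]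
  have h12 := toBlocks₁₂_polyPart hW hP hκ (n := 0) G (fun l => rfl) z
  simp only [Matrix.conjTranspose_zero, hz, hz', sub_zero, zero_sub]
  congr 1
  · have := convSum_descCoeff P G 0 (fun k => (if k = 0 then (1 : Mat N) else 0)ᴴ) z
    refine this.trans ?_
    rw [Finset.sum_range_succ, Finset.sum_eq_zero, zero_add, Nat.sub_self, hD]
    · simp [Bcal]
    · intro j hj
      rw [Finset.mem_range] at hj
      rw [if_neg (by omega), Matrix.conjTranspose_zero, Matrix.mul_zero]
  · have := convSum_descCoeff' P G 0 (fun k => if k = 0 then (1 : Mat N) else 0) z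
    refine (congrArg Neg.neg this).trans ?_
    rw [Finset.sum_range_succ, Finset.sum_eq_zero, zero_add, Nat.sub_self, hD']
    · simp [Bcal, adj]
    · intro j hj
      rw [Finset.mem_range] at hj
      rw [if_neg (by omega), Matrix.zero_mul]

theorem polyPart_eq_Fmat_succ (hW : IsWeight W) (hP : IsMonicOrthogonal W P)
    (hκ : IsNormalizing W P κ) (hY : IsRHSolution W (n + 1) Y) (hc₀ : c 0 = 1)
    (hc : HasExpansion (normalized (n + 1) Y) c) (G : (Mat N)[X]) (z : ℂ) :
    polyPart c G z = Fmat W P κ G (n + 1) z := by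
  set τ : ℂ := 2 * (Real.pi : ℂ) * Complex.I with hτ
  have hτ0 : τ ≠ 0 := two_pi_I_ne_zero
  set m := G.natDegree with hm
  set β : ℕ → Mat N := fun l => -(τ⁻¹ • bcoef W P (n + 1) (((n + 1 : ℕ) : ℤ) + l - 1)) with hβ
  -- The primed sequences are β and δ delayed by one index and freed of their scalar and γ factors.
  -- Their zeroth terms vanish by the convention for b below the diagonal, as `convSum_shift` and
  -- `convSum_shift'` require.
  set β' : ℕ → Mat N := fun l => bcoef W P (n + 1) (((n + 1 : ℕ) : ℤ) + l - 2) with hβ'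
  set δ : ℕ → Mat N := fun l => gam κ n * bcoef W P n ((n : ℤ) + l) with hδ
  set δ' : ℕ → Mat N := fun l => bcoef W P n ((n : ℤ) + l - 1) with hδ'
  set η : ℕ → Mat N := fun l => (c l).toBlocks₂₁ with hη
  have hη0 : η 0 = 0 := by
    ext i j
    simp [hη, hc₀, Matrix.toBlocks₂₁]
  have hηs : ∀ l, η (l + 1) = (-τ) • (gam κ n * descCoeff P n l) := fun l => by
    rw [neg_smul]
    exact toBlocks₂₁_succ hW hP hκ hY hc₀ hc l
  have hηs' : ∀ l, (η (l + 1))ᴴ = τ • ((descCoeff P n l)ᴴ * gam κ n) := fun l => by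
    rw [hηs, Matrix.conjTranspose_smul, star_neg, hτ, star_two_pi_I, neg_neg,
      Matrix.conjTranspose_mul, conjTranspose_gam]
  have hβ0 : β' 0 = 0 := bcoef_of_lt W P (by push_cast; omega)
  have hβs : ∀ k, (-τ⁻¹) • (1 * β' (k + 1)) = β k := fun k => by
    simp only [hβ, hβ']
    rw [neg_smul, Matrix.one_mul]
    congr 3
    push_cast; ring
  have hβs' : ∀ k, τ⁻¹ • ((β' (k + 1))ᴴ * 1) = (β k)ᴴ := fun k => by
    rw [← hβs, Matrix.conjTranspose_smul, star_neg, star_inv₀, hτ, star_two_pi_I, inv_neg, neg_neg,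
      Matrix.one_mul, Matrix.mul_one]
  have hδ0 : δ' 0 = 0 := bcoef_of_lt W P (by simp)
  have hδs : ∀ k, (1 : ℂ) • (gam κ n * δ' (k + 1)) = δ k := fun k => by
    simp only [hδ, hδ']
    rw [one_smul]
    congr 2
    push_cast; ring
  have hδs' : ∀ k, (1 : ℂ) • ((δ' (k + 1))ᴴ * gam κ n) = (δ k)ᴴ := fun k => by
    rw [← hδs, one_smul, one_smul, Matrix.conjTranspose_mul, conjTranspose_gam]
  have hδ1 : ∀ j ∈ Finset.range (m + 1), bcoef W P n ((n : ℤ) + ((m - j : ℕ) : ℤ))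
      = bcoef W P n (((n + 1 : ℕ) : ℤ) + m - j - 1) := fun j hj => by
    rw [Finset.mem_range] at hj
    congr 1
    omega
  have hβ1 : ∀ j ∈ Finset.range (m + 1), β' (m - j)
      = bcoef W P (n + 1) (((n + 1 : ℕ) : ℤ) + m - j - 2) := fun j hj => by
    rw [Finset.mem_range] at hj
    simp only [hβ']
    congr 1
    omega
  have hδ2 : ∀ j ∈ Finset.range (m + 1), δ' (m - j)
      = bcoef W P n ((n : ℤ) + m - j - 1) := fun j hj => by
    rw [Finset.mem_range] at hj
    simp only [hδ']
    congr 1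
    omega
  have e11 : convSum G.coeff m (descCoeff P (n + 1)) (fun k => (δ k)ᴴ) z
      = (∑ j ∈ Finset.range (m + 1), Del P G j (n + 1) z *
        (bcoef W P n (((n + 1 : ℕ) : ℤ) + m - j - 1))ᴴ) * gam κ n := by
    rw [convSum_descCoeff, Finset.sum_mul]
    refine Finset.sum_congr rfl fun j hj => ?_
    simp only [hδ]
    rw [hδ1 j hj, Matrix.conjTranspose_mul, conjTranspose_gam, Matrix.mul_assoc]
  have e11' : convSum (fun p => (G.coeff p)ᴴ) m β (fun k => (η k)ᴴ) z
      = -((∑ j ∈ Finset.range (m + 1), bcoef W P (n + 1) (((n + 1 : ℕ) : ℤ) + m - j - 2) *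
        adj (Del P G j n) z) * gam κ n) := by
    rw [convSum_shift' _ _ (a' := fun l => (-τ⁻¹) • (1 * β' l)) (by simp [hη0]) (by simp [hβ0]) hβs,
      convSum_congr (fun _ => rfl) hηs', convSum_mul_mul, convSum_descCoeff', Matrix.one_mul,
      neg_mul, inv_mul_cancel₀ hτ0, neg_smul, one_smul]
    congr 2
    exact Finset.sum_congr rfl fun j hj => by rw [hβ1 j hj]
  have e21 : convSum G.coeff m η (fun k => (δ k)ᴴ) z
      = -(τ • (gam κ n * (∑ j ∈ Finset.range (m + 1), Del P G j n z *
        (bcoef W P n ((n : ℤ) + m - j - 1))ᴴ) * gam κ n)) := by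
    rw [convSum_shift _ _ (b' := fun l => (1 : ℂ) • ((δ' l)ᴴ * gam κ n)) hη0 (by simp [hδ0]) hδs',
      convSum_congr hηs (fun _ => rfl), convSum_mul_mul, convSum_descCoeff, mul_one, neg_smul]
    congr 4
    exact Finset.sum_congr rfl fun j hj => by rw [hδ2 j hj]
  have e21' : convSum (fun p => (G.coeff p)ᴴ) m δ (fun k => (η k)ᴴ) z
      = τ • (gam κ n * (∑ j ∈ Finset.range (m + 1), bcoef W P n ((n : ℤ) + m - j - 1) *
        adj (Del P G j n) z) * gam κ n) := by
    rw [convSum_shift' _ _ (a' := fun l => (1 : ℂ) • (gam κ n * δ' l)) (by simp [hη0])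
      (by simp [hδ0]) hδs, convSum_congr (fun _ => rfl) hηs', convSum_mul_mul, convSum_descCoeff',
      one_mul]
    congr 3
    exact Finset.sum_congr rfl fun j hj => by rw [hδ2 j hj]
  have e22 : convSum G.coeff m η (fun k => (β k)ᴴ) z
      = -(gam κ n * ∑ j ∈ Finset.range (m + 1), Del P G j n z *
        (bcoef W P (n + 1) (((n + 1 : ℕ) : ℤ) + m - j - 2))ᴴ) := by
    rw [convSum_shift _ _ (b' := fun l => τ⁻¹ • ((β' l)ᴴ * 1)) hη0 (by simp [hβ0]) hβs',
      convSum_congr hηs (fun _ => rfl), convSum_mul_mul, convSum_descCoeff, Matrix.mul_one,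
      neg_mul, mul_inv_cancel₀ hτ0, neg_smul, one_smul]
    congr 2
    exact Finset.sum_congr rfl fun j hj => by rw [hβ1 j hj]
  have e22' : convSum (fun p => (G.coeff p)ᴴ) m δ (fun k => (descCoeff P (n + 1) k)ᴴ) z
      = gam κ n * ∑ j ∈ Finset.range (m + 1), bcoef W P n (((n + 1 : ℕ) : ℤ) + m - j - 1) *
        adj (Del P G j (n + 1)) z := by
    rw [convSum_descCoeff', Finset.mul_sum]
    refine Finset.sum_congr rfl fun j hj => ?_
    simp only [hδ]
    rw [hδ1 j hj, Matrix.mul_assoc]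
  have h12 := toBlocks₁₂_polyPart hW hP hκ (n := n + 1) G (β := β) (fun l => rfl) z
  rw [polyPart_eq_fromBlocks c G (α := descCoeff P (n + 1)) (β := β) (η := η) (δ := δ)
    (toBlocks₁₁_eq hW hP hκ hY hc₀ hc) (toBlocks₁₂_eq hW hP hκ hY hc₀ hc) (fun _ => rfl)
    (toBlocks₂₂_succ hW hP hκ hY hc₀ hc) z, Fmat, h12, e11, e11', e21, e21', e22, e22']
  congr 1
  · rw [Bcal, neg_neg, sub_neg_eq_add, ← Matrix.add_mul, ← Finset.sum_add_distrib]
  -- The sum in 𝓐_n may be extended to j = m at no cost, because b_{n,n-1} = 0; it then has the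
  -- range of the convolutions.
  · have hA : Acal W P κ G n z = -(gam κ n * ∑ j ∈ Finset.range (m + 1),
        (bcoef W P n ((n : ℤ) + m - j - 1) * adj (Del P G j n) z
          + Del P G j n z * (bcoef W P n ((n : ℤ) + m - j - 1))ᴴ)) := by
      rw [Acal, Finset.sum_range_succ _ m, bcoef_of_lt W P (k := (n : ℤ) + m - m - 1) (by omega)]
      simp [hm]
    rw [lowerLeft, hA, Finset.sum_add_distrib, Matrix.mul_add, Matrix.neg_mul, Matrix.add_mul,
      smul_neg, smul_add]
    abel
  · simp only [adj, Bcal, Matrix.conjTranspose_neg, Matrix.conjTranspose_mul, conjTranspose_gam,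
      Matrix.conjTranspose_sum, Matrix.conjTranspose_add, Matrix.conjTranspose_conjTranspose,
      Complex.conj_conj]
    rw [Finset.sum_add_distrib, Matrix.mul_add]
    abel

end

end

/-! ### From the hypotheses on T and S to the main theorem -/

section

variable {N : ℕ}

theorem polyPart_eq_Fmat {W : ℝ → Mat N} {P : ℕ → (Mat N)[X]} {κ : ℕ → Mat N} {n : ℕ}
    {Y : ℂ → BlockMat N} {c : ℕ → BlockMat N} (hW : IsWeight W) (hP : IsMonicOrthogonal W P)
    (hκ : IsNormalizing W P κ) (hY : IsRHSolution W n Y) (hc₀ : c 0 = 1)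
    (hc : HasExpansion (normalized n Y) c) (G : (Mat N)[X]) (z : ℂ) :
    polyPart c G z = Fmat W P κ G n z := by
  cases n with
  | zero => exact polyPart_eq_Fmat_zero hW hP hκ hY hc₀ hc G z
  | succ n => exact polyPart_eq_Fmat_succ hW hP hκ hY hc₀ hc G z

/-- The identity theorem spreads T' = G T from the origin to the plane. Positivity of W at 0 makes
T(0) invertible, and the differential equation carries invertibility to every point. -/
theorem isFactorization_of_eventually {W : ℝ → Mat N} (hW : IsWeight W) {T : ℂ → Mat N}
    (hT : Entire T) (hWT : ∀ x : ℝ, W x = T x * (T x)ᴴ) {G : (Mat N)[X]}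
    (hG : ∀ᶠ z in 𝓝 (0 : ℂ), matDeriv T z = pval G z * T z) : IsFactorization W T G := by
  have hd := hT.matDeriv.eq_of_eventually_eq ((entire_pval G).mul hT) hG
  refine ⟨hT, hT.isUnit_of_matDeriv_eq (entire_pval G) hd (w := ((0 : ℝ) : ℂ)) ?_, hd, hWT⟩
  have h := (hW.posDef 0).isUnit
  rw [hWT] at h
  exact isUnit_of_mul_isUnit_left h

theorem mul_adj_eq_one {S : ℂ → Mat N} (hS : Entire S)
    (hSU : ∀ x : ℝ, S x ∈ Matrix.unitaryGroup (Fin N) ℂ) (z : ℂ) : S z * adj S z = 1 :=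
  (hS.mul hS.adj).eq_of_eq_ofReal (entire_const 1)
    (fun x => by rw [adj_ofReal]; exact Matrix.mem_unitaryGroup_iff.1 (hSU x)) z

/-- Differentiate S S^* = 1: the two terms are χ and χ^*. -/
theorem adj_chi {S : ℂ → Mat N} (hS : Entire S) (h : ∀ z, S z * adj S z = 1) (z : ℂ) :
    adj (chi S) z = -chi S z := by
  have h1 := (hS.hasMatDerivAt z).mul (hS.adj.hasMatDerivAt z)
  have h2 := h1.unique ((hasMatDerivAt_const 1 z).congr (Eventually.of_forall h))
  have h3 : adj (chi S) z = S z * matDeriv (adj S) z := by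
    rw [hS.matDeriv_adj]
    simp [adj, chi, Matrix.conjTranspose_mul]
  rw [h3]
  exact eq_neg_of_add_eq_zero_right h2

end

end MatrixOP

theorem mainTheorem5 {N : ℕ} (W : ℝ → MatrixOP.Mat N) (hW : MatrixOP.IsWeight W)
    (P : ℕ → (MatrixOP.Mat N)[X]) (hP : MatrixOP.IsMonicOrthogonal W P)
    (κ : ℕ → MatrixOP.Mat N) (hκ : MatrixOP.IsNormalizing W P κ)
    (T : ℂ → MatrixOP.Mat N) (hT : MatrixOP.Entire T)
    (hWT : ∀ x : ℝ, W x = T x * (T x)ᴴ)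
    (G : (MatrixOP.Mat N)[X])
    (hG : ∀ᶠ z in 𝓝 (0 : ℂ), MatrixOP.matDeriv T z = MatrixOP.pval G z * T z)
    (S : ℂ → MatrixOP.Mat N) (hS : MatrixOP.Entire S)
    (hSdet : ∀ z : ℂ, IsUnit (S z))
    (hSU : ∀ x : ℝ, S x ∈ Matrix.unitaryGroup (Fin N) ℂ)
    (H : (MatrixOP.Mat N)[X])
    (hH : ∀ z : ℂ, MatrixOP.pval H z =
      T z * MatrixOP.matDeriv S z * MatrixOP.adj S z * (T z)⁻¹) :
    (∀ x : ℝ, W x = (T x * S x) * (T x * S x)ᴴ) ∧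
    (∀ z : ℂ, MatrixOP.HasMatDerivAt (fun w => T w * S w)
      ((MatrixOP.pval G z + MatrixOP.pval H z) * (T z * S z)) z) ∧
    (∀ (n : ℕ) (Y : ℂ → MatrixOP.BlockMat N), MatrixOP.IsRHSolution W n Y →
      ∀ z : ℂ, z.im ≠ 0 →
        MatrixOP.HasMatDerivAt (MatrixOP.Xmat Y T)
          (MatrixOP.Fmat W P κ G n z * MatrixOP.Xmat Y T z) z ∧
        MatrixOP.HasMatDerivAt (MatrixOP.Xmat Y T)
          ((MatrixOP.Fmat W P κ G n z + MatrixOP.Fmat W P κ H n z) * MatrixOP.Xmat Y T z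
            - MatrixOP.Xmat Y T z * Matrix.fromBlocks
                (MatrixOP.chi S z) 0 0 (-MatrixOP.adj (MatrixOP.chi S) z)) z) := by
  open MatrixOP in
  have hF := isFactorization_of_eventually hW hT hWT hG
  have hSS := mul_adj_eq_one hS hSU
  have hSS' : ∀ z, adj S z * S z = 1 := fun z => mul_eq_one_comm.1 (hSS z)
  have hHT : ∀ z, pval H z * T z = T z * chi S z := fun z => by
    rw [hH, Matrix.mul_assoc _ (T z)⁻¹, inv_mul_of_isUnit (hF.isUnit z), Matrix.mul_one,
      Matrix.mul_assoc, chi]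
  refine ⟨fun x => ?_, fun z => ?_, fun n Y hY z hz => ?_⟩
  · rw [Matrix.conjTranspose_mul, Matrix.mul_assoc (T x), ← Matrix.mul_assoc (S x),
      ← adj_ofReal S x, hSS, Matrix.one_mul, hWT]
  · have h := (hT.hasMatDerivAt z).mul (hS.hasMatDerivAt z)
    have e : (pval G z + pval H z) * (T z * S z)
        = matDeriv T z * S z + T z * matDeriv S z := by
      rw [Matrix.add_mul, ← Matrix.mul_assoc, ← Matrix.mul_assoc, hHT, ← hF.matDeriv_eq, chi,
        Matrix.mul_assoc (T z), Matrix.mul_assoc (matDeriv S z), hSS', Matrix.mul_one]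
    rw [e]
    exact h
  · obtain ⟨c, hc₀, hc⟩ := hY.exists_expansion
    have h1 := hF.hasMatDerivAt_Xmat_polyPart hY hc₀ hc hz
    -- With A = χ this reads F_n(z; H) X = X diag(χ, χ). As -χ^* = χ, the two additional terms of
    -- the second equation cancel, and it reduces to the first.
    have h2 := hF.polyPart_mul_Xmat hY hc₀ hc (hS.matDeriv.mul hS.adj) (adj_chi hS hSS) hHT hz
    rw [polyPart_eq_Fmat hW hP hκ hY hc₀ hc] at h1 h2
    refine ⟨h1, ?_⟩
    rw [Matrix.add_mul, h2, adj_chi hS hSS, neg_neg]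
    exact (add_sub_cancel_right (Fmat W P κ G n z * Xmat Y T z) _).symm ▸ h1
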